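/- Let $K$ be a field and let $Q_\Lambda$ be a finite quiver in which every vertex is the source or the target of at least one arrow (for instance, a connected quiver with at least one arrow). Paths are composed from left to right. A cycle is a closed path of positive length; it is simple if it has no repeated arrows. A defining pair $(\mathcal S,\mu)$ in $Q_\Lambda$ consists of a set $\mathcal S$ of simple cycles and a function $\mu\colon\mathcal S\to\mathbb Z_{>0}$ such that: (D0) if $C\in\mathcal S$ is a loop, then $\mu(C)>1$; (D1) $\mathcal S$ is closed under cyclic permutations; (D2) $\mu(C)=\mu(C')$ if $C\in\mathcal S$ and $C'$ is a cyclic permutation of $C$; (D3) every arrow occurs in some cycle in $\mathcal S$; (D4) if an arrow occurs in two cycles in $\mathcal S$, they are cyclic permutations of each other. Let $(\mathcal S,\mu)$ be a defining pair in $Q_\Lambda$ with $\mu\equiv 1$, and let $\Lambda=KQ_\Lambda/I_\Lambda$ be the (symmetric special multiserial) algebra defined by it: $I_\Lambda$ is the two-sided ideal generated by all $C^{\mu(C)}-C'^{\mu(C')}$ with $C,C'\in\mathcal S$ cycles at the same vertex, all $C^{\mu(C)}a$ with $C\in\mathcal S$ and $a$ the first arrow of $C$, and all paths $ab$ of length two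 that are not a subpath of any $C\in\mathcal S$. Let $D$ be an admissible cut of $Q_\Lambda$, that is, a set of arrows of $Q_\Lambda$ that contains exactly one arrow of each cycle in $\mathcal S$, and let $A=KQ_\Lambda/\langle I_\Lambda\cup D\rangle$ be the cut algebra associated to $D$. Then $A$ is almost gentle, that is, $A$ is Morita equivalent over $K$ to an algebra $KQ/I$ with $Q$ a finite quiver and $I$ an admissible ideal generated by paths of length two such that for every arrow $a$ of $Q$ there is at most one arrow $b$ with $ab\notin I$ and at most one arrow $c$ with $ca\notin I$. Moreover, the trivial extension $T(A)=A\ltimes \operatorname{Hom}_K(A,K)$, with multiplication $(a,f)(b,g)=(ab,ag+fb)$, where $(ag)(x)=g(xa)$ and $(fb)(x)=f(bx)$, is isomorphic to $\Lambda$ as a $K$-algebra. -/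

import Mathlib

universe k u v w

open Quiver

noncomputable section

/-! ## Path algebras -/

/-- The list of arrows of a path, in the order in which they are traversed. -/
def Quiver.Path.arrows {V : Type u} [Quiver.{v} V] {a : V} :
    ∀ {b : V}, Path a b → List (Total V)
  | _, Path.nil => []
  | _, Path.cons p e => p.arrows ++ [⟨_, _, e⟩]

/-- All paths of a quiver, with arbitrary end points (including the trivial paths). -/
abbrev AnyPath (V : Type u) [Quiver.{v} V] : Type (max u v) :=
  Σ a b : V, Path a b

/-- The path algebra `K Q` as a vector space: its basis is the set of all paths of `Q`. -/
def PathAlgebra (K : Type k) (V : Type u) [Field K] [Quiver.{v} V] : Type (max k u v) :=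
  AnyPath V →₀ K

namespace PathAlgebra

variable {K : Type k} {V : Type u} [Field K] [Quiver.{v} V]

instance : AddCommGroup (PathAlgebra K V) := inferInstanceAs (AddCommGroup (AnyPath V →₀ K))

instance : Module K (PathAlgebra K V) := inferInstanceAs (Module K (AnyPath V →₀ K))

variable (K) in
/-- A path, as an element of the path algebra. -/
def ofAnyPath (p : AnyPath V) : PathAlgebra K V := Finsupp.single p (1 : K)

variable (K V) in
/-- The paths form a basis of the path algebra. -/
def pathBasis : Module.Basis (AnyPath V) K (PathAlgebra K V) :=
  Module.Basis.ofRepr (LinearEquiv.refl K (AnyPath V →₀ K) : PathAlgebra K V ≃ₗ[K] (AnyPath V →₀ K))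

theorem pathBasis_apply (p : AnyPath V) : pathBasis K V p = ofAnyPath K p := rfl

variable (K) in
/-- A path, as an element of the path algebra. -/
def ofPath {a b : V} (p : Path a b) : PathAlgebra K V := ofAnyPath K ⟨a, b, p⟩

variable (K) in
/-- An arrow, as an element of the path algebra. -/
def ofArrow (a : Total V) : PathAlgebra K V := ofPath K a.hom.toPath

variable (K) in
open Classical in
/-- The product of two paths: `p` followed by `q` if `p` ends where `q` starts, and zero
otherwise. -/
def pathMul (p q : AnyPath V) : PathAlgebra K V :=
  if h : p.2.1 = q.1 then ofPath K (p.2.2.comp (q.2.2.cast h.symm rfl)) else 0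

variable (K V) in
/-- The bilinear extension of the product of paths. -/
def mulLin : PathAlgebra K V →ₗ[K] PathAlgebra K V →ₗ[K] PathAlgebra K V :=
  (pathBasis K V).constr K fun p => (pathBasis K V).constr K fun q => pathMul K p q

instance : Mul (PathAlgebra K V) := ⟨fun x y => mulLin K V x y⟩

/-- The identity is the sum of the trivial paths. -/
instance [Fintype V] : One (PathAlgebra K V) := ⟨∑ a : V, ofPath K (Path.nil : Path a a)⟩

theorem mul_def (x y : PathAlgebra K V) : x * y = mulLin K V x y := rfl

theorem one_def [Fintype V] :
    (1 : PathAlgebra K V) = ∑ a : V, ofPath K (Path.nil : Path a a) := rfl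

theorem ofAnyPath_mul_ofAnyPath (p q : AnyPath V) :
    ofAnyPath K p * ofAnyPath K q = pathMul K p q := by
  rw [mul_def, mulLin, ← pathBasis_apply, ← pathBasis_apply, Module.Basis.constr_basis,
    Module.Basis.constr_basis]

theorem ofPath_mul_ofPath {a b c : V} (p : Path a b) (q : Path b c) :
    ofPath K p * ofPath K q = ofPath K (p.comp q) := by
  simp [ofPath, ofAnyPath_mul_ofAnyPath, pathMul]

theorem ofPath_mul_ofPath_of_ne {a b c d : V} (p : Path a b) (q : Path c d) (h : b ≠ c) :
    ofPath K p * ofPath K q = 0 := by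
  simp [ofPath, ofAnyPath_mul_ofAnyPath, pathMul, h]

theorem induction_on {P : PathAlgebra K V → Prop} (x : PathAlgebra K V) (zero : P 0)
    (add : ∀ x y, P x → P y → P (x + y))
    (single : ∀ (c : K) {a b : V} (p : Path a b), P (c • ofPath K p)) : P x := by
  refine Finsupp.induction_linear (motive := P) x zero (fun f g hf hg => add f g hf hg) ?_
  rintro ⟨a, b, p⟩ c
  have h : (Finsupp.single ⟨a, b, p⟩ c : AnyPath V →₀ K) =
      c • (Finsupp.single ⟨a, b, p⟩ (1 : K) : AnyPath V →₀ K) := by simp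
  rw [h]
  exact single c p

protected theorem add_mul (x y z : PathAlgebra K V) : (x + y) * z = x * z + y * z := by
  simp [mul_def]

protected theorem mul_add (x y z : PathAlgebra K V) : x * (y + z) = x * y + x * z := by
  simp [mul_def]

protected theorem smul_mul (c : K) (x y : PathAlgebra K V) : (c • x) * y = c • (x * y) := by
  simp [mul_def]

protected theorem mul_smul (c : K) (x y : PathAlgebra K V) : x * (c • y) = c • (x * y) := by
  simp [mul_def]

protected theorem zero_mul (x : PathAlgebra K V) : 0 * x = 0 := by
  simp [mul_def]

protected theorem mul_zero (x : PathAlgebra K V) : x * 0 = 0 := by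
  simp [mul_def]

protected theorem mul_assoc (x y z : PathAlgebra K V) : x * y * z = x * (y * z) := by
  induction x using induction_on with
  | zero => simp only [PathAlgebra.zero_mul]
  | add x x' h h' => simp only [PathAlgebra.add_mul, h, h']
  | single c p =>
  induction y using induction_on with
  | zero => simp only [PathAlgebra.zero_mul, PathAlgebra.mul_zero]
  | add x x' h h' => simp only [PathAlgebra.add_mul, PathAlgebra.mul_add, h, h']
  | single d q =>
  induction z using induction_on with
  | zero => simp only [PathAlgebra.mul_zero]
  | add x x' h h' => simp only [PathAlgebra.mul_add, h, h']
  | @single e a' b' r =>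
  rename_i a b a₁ b₁
  simp only [PathAlgebra.smul_mul, PathAlgebra.mul_smul]
  congr 3
  by_cases h₁ : b = a₁
  · subst h₁
    by_cases h₂ : b₁ = a'
    · subst h₂
      simp only [ofPath_mul_ofPath, Path.comp_assoc]
    · simp only [ofPath_mul_ofPath, ofPath_mul_ofPath_of_ne _ _ h₂, PathAlgebra.mul_zero]
  · by_cases h₂ : b₁ = a'
    · subst h₂
      simp only [ofPath_mul_ofPath, ofPath_mul_ofPath_of_ne _ _ h₁, PathAlgebra.zero_mul]
    · simp only [ofPath_mul_ofPath_of_ne _ _ h₁, ofPath_mul_ofPath_of_ne _ _ h₂,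
        PathAlgebra.zero_mul, PathAlgebra.mul_zero]

protected theorem one_mul [Fintype V] (x : PathAlgebra K V) : 1 * x = x := by
  induction x using induction_on with
  | zero => simp only [PathAlgebra.mul_zero]
  | add x x' h h' => simp only [PathAlgebra.mul_add, h, h']
  | @single c a b p =>
  rw [PathAlgebra.mul_smul, one_def, mul_def, map_sum, LinearMap.sum_apply,
    Finset.sum_eq_single a]
  · rw [← mul_def, ofPath_mul_ofPath, Path.nil_comp]
  · intro b _ hb
    rw [← mul_def, ofPath_mul_ofPath_of_ne _ _ hb]
  · simp

protected theorem mul_one [Fintype V] (x : PathAlgebra K V) : x * 1 = x := by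
  induction x using induction_on with
  | zero => simp only [PathAlgebra.zero_mul]
  | add x x' h h' => simp only [PathAlgebra.add_mul, h, h']
  | @single c a b p =>
  rw [PathAlgebra.smul_mul, one_def, mul_def, map_sum, Finset.sum_eq_single b]
  · rw [← mul_def, ofPath_mul_ofPath, Path.comp_nil]
  · intro b' _ hb
    rw [← mul_def, ofPath_mul_ofPath_of_ne _ _ (Ne.symm hb)]
  · simp

instance [Fintype V] : Ring (PathAlgebra K V) :=
  { (inferInstance : AddCommGroup (PathAlgebra K V)),
    (inferInstance : Mul (PathAlgebra K V)),
    (inferInstance : One (PathAlgebra K V)) with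
    left_distrib := PathAlgebra.mul_add
    right_distrib := PathAlgebra.add_mul
    zero_mul := PathAlgebra.zero_mul
    mul_zero := PathAlgebra.mul_zero
    mul_assoc := PathAlgebra.mul_assoc
    one_mul := PathAlgebra.one_mul
    mul_one := PathAlgebra.mul_one }

instance [Fintype V] : Algebra K (PathAlgebra K V) :=
  Algebra.ofModule PathAlgebra.smul_mul fun c x y => PathAlgebra.mul_smul c x y

/-- An ideal `I` of `K Q` is admissible if `J ^ N ⊆ I ⊆ J ^ 2` for some `N`, where `J` is the ideal
generated by the arrows. Here `J ^ n` is the span of all paths of length at least `n`. -/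
def IsAdmissible [Fintype V] (I : TwoSidedIdeal (PathAlgebra K V)) : Prop :=
  (∃ N : ℕ, ∀ p : AnyPath V, N ≤ p.2.2.length → ofAnyPath K p ∈ I) ∧
    ∀ x ∈ I, x ∈ Submodule.span K (ofAnyPath K '' {p : AnyPath V | 2 ≤ p.2.2.length})

/-- The ideal `I` of `K Q` is generated by paths of length two. -/
def IsGeneratedByPathsOfLengthTwo [Fintype V] (I : TwoSidedIdeal (PathAlgebra K V)) : Prop :=
  ∃ R : Set (AnyPath V), (∀ p ∈ R, p.2.2.length = 2) ∧ I = TwoSidedIdeal.span (ofAnyPath K '' R)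

/-- The special multiserial condition on `K Q / I`: for every arrow `a` there is at most one arrow
`b` with `a b ∉ I` and at most one arrow `c` with `c a ∉ I`. (Products of non-composable arrows are
zero, hence lie in `I`.) -/
def IsSpecialMultiserialIdeal [Fintype V] (I : TwoSidedIdeal (PathAlgebra K V)) : Prop :=
  (∀ a b b' : Total V, ofArrow K a * ofArrow K b ∉ I → ofArrow K a * ofArrow K b' ∉ I → b = b') ∧
    ∀ a c c' : Total V, ofArrow K c * ofArrow K a ∉ I → ofArrow K c' * ofArrow K a ∉ I → c = c'

end PathAlgebra

/-- A `K`-algebra is almost gentle if it is Morita equivalent to `K Q / I`, for a finite quiver `Q`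
and an admissible ideal `I` that is generated by paths of length two, such that for every
arrow `a` of `Q` there is at most one arrow `b` with `a b ∉ I` and at most one arrow `c` with
`c a ∉ I`. (The universes `u`, `v` of the quiver are immaterial, as it is finite.) -/
def IsAlmostGentle (K : Type k) (A : Type w) [Field K] [Ring A] [Algebra K A] : Prop :=
  ∃ (W : Type u) (_ : Fintype W) (_ : Quiver.{v} W) (_ : ∀ a b : W, Finite (a ⟶ b))
    (I : TwoSidedIdeal (PathAlgebra K W)),
    PathAlgebra.IsAdmissible I ∧ PathAlgebra.IsGeneratedByPathsOfLengthTwo I ∧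
      PathAlgebra.IsSpecialMultiserialIdeal I ∧ IsMoritaEquivalent K A I.ringCon.Quotient

/-! ## Algebras defined by cycles -/

/-- Two closed paths are cyclic permutations of each other. -/
def IsCyclicPermutation {V : Type u} [Quiver.{v} V] {a b : V} (C : Path a a) (C' : Path b b) :
    Prop :=
  ∃ (p : Path a b) (q : Path b a), C = p.comp q ∧ C' = q.comp p

/-- A defining pair `(S, μ)` in a quiver: a set `S` of simple cycles (closed paths of positive
length without repeated arrows) and a function `μ : S → ℤ_{>0}` (values outside of `S` are
irrelevant) subject to the following conditions. -/
structure DefiningPair (V : Type u) [Quiver.{v} V] where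
  /-- The cycles in `S` at a given vertex, called the special cycles. -/
  cycles : ∀ a : V, Set (Path a a)
  /-- The multiplicity function. -/
  mult : ∀ {a : V}, Path a a → ℕ+
  length_pos : ∀ {a : V}, ∀ C ∈ cycles a, 0 < C.length
  simple : ∀ {a : V}, ∀ C ∈ cycles a, C.arrows.Nodup
  /-- If a loop is in `S`, its multiplicity is larger than one. -/
  one_lt_mult_of_loop : ∀ {a : V}, ∀ C ∈ cycles a, C.length = 1 → 1 < mult C
  /-- `S` is closed under cyclic permutations. -/
  cycles_perm : ∀ {a b : V} (C : Path a a) (C' : Path b b),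
    C ∈ cycles a → IsCyclicPermutation C C' → C' ∈ cycles b
  /-- The multiplicity is invariant under cyclic permutations. -/
  mult_perm : ∀ {a b : V} (C : Path a a) (C' : Path b b),
    C ∈ cycles a → IsCyclicPermutation C C' → mult C = mult C'
  /-- Every arrow occurs in some cycle in `S`. -/
  exists_mem_cycle : ∀ e : Total V, ∃ (a : V) (C : Path a a), C ∈ cycles a ∧ e ∈ C.arrows
  /-- If an arrow occurs in two cycles in `S`, they are cyclic permutations of each other. -/
  perm_of_common_arrow : ∀ {a b : V} (C : Path a a) (C' : Path b b) (e : Total V),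
    C ∈ cycles a → C' ∈ cycles b → e ∈ C.arrows → e ∈ C'.arrows → IsCyclicPermutation C C'

namespace DefiningPair

variable {V : Type u} [Quiver.{v} V] (S : DefiningPair V) (K : Type k) [Field K]

/-- The relations of Type 1: `C ^ μ(C) - C' ^ μ(C')` for special cycles `C`, `C'` at the same
vertex. -/
def type1 [Fintype V] : Set (PathAlgebra K V) :=
  {x | ∃ (a : V) (C C' : Path a a), C ∈ S.cycles a ∧ C' ∈ S.cycles a ∧
    x = PathAlgebra.ofPath K C ^ (S.mult C : ℕ) - PathAlgebra.ofPath K C' ^ (S.mult C' : ℕ)}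

/-- The relations of Type 2: `C ^ μ(C) e` for a special cycle `C` with first arrow `e`. -/
def type2 [Fintype V] : Set (PathAlgebra K V) :=
  {x | ∃ (a : V) (C : Path a a) (e : Total V), C ∈ S.cycles a ∧ C.arrows.head? = some e ∧
    x = PathAlgebra.ofPath K C ^ (S.mult C : ℕ) * PathAlgebra.ofArrow K e}

/-- The relations of Type 3: the paths `e f` of length two that do not lie on any special cycle. -/
def type3 : Set (PathAlgebra K V) :=
  {x | ∃ (a b c : V) (e : a ⟶ b) (f : b ⟶ c),
    (¬ ∃ (d : V) (C : Path d d), C ∈ S.cycles d ∧ (e.toPath.comp f.toPath).arrows <:+: C.arrows) ∧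
    x = PathAlgebra.ofPath K (e.toPath.comp f.toPath)}

/-- The ideal `I_Λ` generated by all relations of Types 1, 2 and 3. -/
def ideal [Fintype V] : TwoSidedIdeal (PathAlgebra K V) :=
  TwoSidedIdeal.span (S.type1 K ∪ S.type2 K ∪ S.type3 K)

/-- The algebra `Λ = K Q_Λ / I_Λ` defined by the cycles `(S, μ)`. -/
abbrev algebra [Fintype V] : Type (max k u v) :=
  (S.ideal K).ringCon.Quotient

/-- A set `D` of arrows is an admissible cut if it contains exactly one arrow of each special
cycle. (As the special cycles cover all arrows, `D` has no other arrows. Cyclic permutations have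
the same arrows, so it does not matter that one may restrict to representatives.) -/
def IsAdmissibleCut (D : Set (Total V)) : Prop :=
  ∀ (a : V) (C : Path a a), C ∈ S.cycles a → ∃! e : Total V, e ∈ D ∧ e ∈ C.arrows

/-- The ideal generated by `I_Λ ∪ D`. -/
def cutIdeal [Fintype V] (D : Set (Total V)) : TwoSidedIdeal (PathAlgebra K V) :=
  TwoSidedIdeal.span ((S.ideal K : Set (PathAlgebra K V)) ∪ PathAlgebra.ofArrow K '' D)

/-- The cut algebra `K Q_Λ / ⟨I_Λ ∪ D⟩`. -/
abbrev cutAlgebra [Fintype V] (D : Set (Total V)) : Type (max k u v) :=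
  (S.cutIdeal K D).ringCon.Quotient

end DefiningPair

/-! ## Trivial extensions -/

/-- The `K`-linear dual `D(A) = Hom_K(A, K)`, as an `A`-`A`-bimodule. -/
def DualBimodule (K : Type k) (A : Type w) [Field K] [Ring A] [Algebra K A] : Type (max k w) :=
  A →ₗ[K] K

namespace DualBimodule

variable {K : Type k} {A : Type w} [Field K] [Ring A] [Algebra K A]

instance : AddCommGroup (DualBimodule K A) := inferInstanceAs (AddCommGroup (A →ₗ[K] K))

instance : Module K (DualBimodule K A) := inferInstanceAs (Module K (A →ₗ[K] K))

instance : FunLike (DualBimodule K A) A K := inferInstanceAs (FunLike (A →ₗ[K] K) A K)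

instance : LinearMapClass (DualBimodule K A) K A K :=
  inferInstanceAs (LinearMapClass (A →ₗ[K] K) K A K)

@[ext]
theorem ext {f g : DualBimodule K A} (h : ∀ x, f x = g x) : f = g :=
  LinearMap.ext (f := (f : A →ₗ[K] K)) (g := g) h

@[simp] theorem add_apply (f g : DualBimodule K A) (x : A) : (f + g) x = f x + g x := rfl

@[simp] theorem zero_apply (x : A) : (0 : DualBimodule K A) x = 0 := rfl

@[simp] theorem smul_apply (c : K) (f : DualBimodule K A) (x : A) : (c • f) x = c * f x := rfl

/-- The left action `(a f)(x) = f (x a)`. -/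
instance : SMul A (DualBimodule K A) :=
  ⟨fun a f => LinearMap.comp (f : A →ₗ[K] K) (LinearMap.mulRight K a)⟩

/-- The right action `(f a)(x) = f (a x)`. -/
instance : SMul Aᵐᵒᵖ (DualBimodule K A) :=
  ⟨fun a f => LinearMap.comp (f : A →ₗ[K] K) (LinearMap.mulLeft K a.unop)⟩

@[simp] theorem left_smul_apply (a : A) (f : DualBimodule K A) (x : A) : (a • f) x = f (x * a) :=
  rfl

@[simp] theorem right_smul_apply (a : Aᵐᵒᵖ) (f : DualBimodule K A) (x : A) :
    (a • f) x = f (a.unop * x) :=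
  rfl

instance : Module A (DualBimodule K A) where
  one_smul f := by ext; simp
  mul_smul a b f := by ext; simp [mul_assoc]
  smul_zero a := by ext; simp
  smul_add a f g := by ext; simp
  add_smul a b f := by ext; simp [mul_add]
  zero_smul f := by ext; simp

instance : Module Aᵐᵒᵖ (DualBimodule K A) where
  one_smul f := by ext; simp
  mul_smul a b f := by ext; simp [mul_assoc]
  smul_zero a := by ext; simp
  smul_add a f g := by ext; simp
  add_smul a b f := by ext; simp [add_mul]
  zero_smul f := by ext; simp

instance : SMulCommClass A Aᵐᵒᵖ (DualBimodule K A) where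
  smul_comm a b f := by ext; simp [mul_assoc]

instance : IsScalarTower K A (DualBimodule K A) where
  smul_assoc c a f := by ext; simp

instance : IsScalarTower K Aᵐᵒᵖ (DualBimodule K A) where
  smul_assoc c a f := by ext; simp

end DualBimodule

/-- The trivial extension `T(A) = A ⋉ D(A)`: the vector space `A × D(A)` with the multiplication
`(a, f) (b, g) = (a b, a g + f b)`. -/
abbrev TrivialExtension (K : Type k) (A : Type w) [Field K] [Ring A] [Algebra K A] :
    Type (max k w) :=
  TrivSqZeroExt A (DualBimodule K A)

end

/-! A path is completable if it begins some special cycle. By (D4) and simplicity, a path of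
positive length has at most one completion (`completion_unique`). Since μ = 1, every path of
positive length that is not completable lies in I_Λ (`ofPath_mem_ideal`). Hence Λ is spanned by the
completable paths together with the trivial ones, and special cycles at the same vertex are
identified.

Every special cycle meets D exactly once. Modulo D the relations of Types 1 and 2 therefore
disappear, and A is the path algebra of the quiver without D modulo the non-completable paths of
length two. Unique completion of an arrow is the almost gentle condition.

For the trivial extension, let φ (`traceForm`) be 1 on special cycles and 0 on all other paths;
closure under rotation makes it symmetric. If pq is a special cycle, exactly one of p, q runs
through D, so φ pairs the paths through D with those avoiding D. With c(x) the part of x supported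
on paths through D (`cutPart`), the isomorphism is induced by x ↦ (class of x, φ(c(x) ·)). It is
multiplicative because c(xy) = x c(y) + c(x) y - c(x) c(y) and φ annihilates c(x) times the cut
ideal (`traceForm_cutPart_mul_eq_zero`). Completions of paths form a dual basis, which gives
surjectivity (`dual_eq_dualPart_sum`) and shows that the kernel is I_Λ
(`cutPart_sub_sum_mem_ideal`). -/

noncomputable section

/-! ### Paths and their lists of arrows -/

namespace Quiver.Path

variable {V : Type u} [Quiver.{v} V] {a b c : V}

@[simp]
theorem arrows_nil : (Path.nil : Path a a).arrows = [] := rfl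

@[simp]
theorem arrows_cons (p : Path a b) (e : b ⟶ c) : (p.cons e).arrows = p.arrows ++ [⟨b, c, e⟩] := rfl

@[simp]
theorem arrows_comp (p : Path a b) (q : Path b c) :
    (p.comp q).arrows = p.arrows ++ q.arrows := by
  induction q with
  | nil => simp
  | cons q e ih => simp [ih]

@[simp]
theorem arrows_toPath (e : a ⟶ b) : e.toPath.arrows = [⟨a, b, e⟩] := rfl

@[simp]
theorem length_arrows (p : Path a b) : p.arrows.length = p.length := by
  induction p with
  | nil => rfl
  | cons p e ih => simp [ih]

theorem eq_of_arrows_eq {p q : Path a b} (h : p.arrows = q.arrows) : p = q := by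
  induction p with
  | nil =>
    cases q with
    | nil => rfl
    | cons q f => simp at h
  | cons p e ih =>
    cases q with
    | nil => simp at h
    | cons q f =>
      simp only [arrows_cons] at h
      obtain ⟨h₁, h₂⟩ := List.append_inj' h rfl
      cases h₂
      rw [ih h₁]

theorem arrows_head?_left {p : Path a b} {e : Total V} (h : p.arrows.head? = some e) :
    e.left = a := by
  induction p with
  | nil => simp at h
  | cons p f ih =>
    cases p with
    | nil => simp only [arrows_cons, arrows_nil, List.nil_append, List.head?_cons,
        Option.some.injEq] at h; rw [← h]
    | cons p g => exact ih (by simpa using h)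

theorem arrows_getLast?_right {p : Path a b} {e : Total V} (h : p.arrows.getLast? = some e) :
    e.right = b := by
  cases p with
  | nil => simp at h
  | cons p f =>
    simp only [arrows_cons, List.getLast?_append, List.getLast?_singleton, Option.some_or,
      Option.some.injEq] at h
    rw [← h]

/-- A path of positive length is determined, including its end points, by its arrows. -/
theorem sigma_eq_of_arrows_eq {a' b' : V} {p : Path a b} {q : Path a' b'}
    (h : p.arrows = q.arrows) (hp : p.arrows ≠ []) :
    (⟨a, b, p⟩ : AnyPath V) = ⟨a', b', q⟩ := by
  have ha : a = a' := by
    obtain ⟨e, he⟩ := Option.ne_none_iff_exists'.1 (mt List.head?_eq_none_iff.1 hp)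
    rw [← arrows_head?_left he, arrows_head?_left (h ▸ he : q.arrows.head? = some e)]
  have hb : b = b' := by
    obtain ⟨e, he⟩ := Option.ne_none_iff_exists'.1 (mt List.getLast?_eq_none_iff.1 hp)
    rw [← arrows_getLast?_right he, arrows_getLast?_right (h ▸ he : q.arrows.getLast? = some e)]
  subst ha hb
  rw [eq_of_arrows_eq h]

theorem exists_eq_comp_of_arrows_eq_append {p : Path a b} {l₁ l₂ : List (Total V)}
    (h : p.arrows = l₁ ++ l₂) :
    ∃ (c : V) (p₁ : Path a c) (p₂ : Path c b),
      p = p₁.comp p₂ ∧ p₁.arrows = l₁ ∧ p₂.arrows = l₂ := by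
  obtain ⟨c, p₁, p₂, rfl, hl⟩ := p.exists_eq_comp_of_le_length (n := l₁.length)
    (by rw [← length_arrows, h]; simp)
  rw [arrows_comp] at h
  obtain ⟨h₁, h₂⟩ := List.append_inj h (by rw [length_arrows, hl])
  exact ⟨c, p₁, p₂, rfl, h₁, h₂⟩

theorem exists_eq_comp_comp_of_infix {a' b' : V} {p : Path a b} {C : Path a' b'}
    (h : p.arrows <:+: C.arrows) (hp : p.arrows ≠ []) :
    ∃ (x : Path a' a) (y : Path b b'), C = x.comp (p.comp y) := by
  obtain ⟨l₁, l₂, h⟩ := h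
  rw [List.append_assoc] at h
  obtain ⟨c, x, q, rfl, -, hq⟩ := exists_eq_comp_of_arrows_eq_append h.symm
  obtain ⟨d, p', y, rfl, hp', -⟩ := exists_eq_comp_of_arrows_eq_append hq
  cases sigma_eq_of_arrows_eq hp' (hp' ▸ hp)
  exact ⟨x, y, rfl⟩

theorem exists_eq_comp_comp_of_mem {a' b' : V} {e : Total V} {C : Path a' b'}
    (h : e ∈ C.arrows) :
    ∃ (x : Path a' e.left) (y : Path e.right b'), C = x.comp (e.hom.toPath.comp y) :=
  exists_eq_comp_comp_of_infix (p := e.hom.toPath)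
    (by simpa using (List.singleton_infix_iff _ _).2 h) (by simp)

end Quiver.Path

/-! ### Completing paths to special cycles -/

namespace DefiningPair

variable {V : Type u} [Quiver.{v} V] (S : DefiningPair V)

variable {S} in
theorem comp_mem_cycles {a b : V} {p : Path a b} {q : Path b a} (h : p.comp q ∈ S.cycles a) :
    q.comp p ∈ S.cycles b :=
  S.cycles_perm _ _ h ⟨p, q, rfl, rfl⟩

variable {S} in
/-- A path of positive length can be completed to a special cycle in at most one way. -/
theorem completion_unique {a b : V} {p : Path a b} {x y : Path b a} (hp : 0 < p.length)
    (hx : p.comp x ∈ S.cycles a) (hy : p.comp y ∈ S.cycles a) : x = y := by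
  obtain ⟨e, l, hl⟩ := List.exists_cons_of_length_pos (by rwa [← Path.length_arrows] at hp)
  -- By (D4) the two cycles are `rs` and `sr`, and both begin with the first arrow `e` of `p`. If
  -- `r` and `s` were both nontrivial, each would begin with `e`, which would then be repeated in
  -- `rs`. So one of them is trivial and the cycles agree.
  obtain ⟨r, s, hr, hs⟩ := S.perm_of_common_arrow _ _ e hx hy (by simp [hl]) (by simp [hl])
  suffices h : (p.comp x).arrows = (p.comp y).arrows from
    Path.comp_injective_right p (Path.eq_of_arrows_eq h)
  have hn := S.simple _ hx
  rw [hr, Path.arrows_comp] at hn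
  have h₁ := congrArg Path.arrows hr
  have h₂ := congrArg Path.arrows hs
  simp only [Path.arrows_comp] at h₁ h₂ ⊢
  rw [h₁, h₂]
  rw [hl] at h₁ h₂
  generalize r.arrows = R at *
  generalize s.arrows = T at *
  cases R with
  | nil => simp
  | cons f R =>
    cases T with
    | nil => simp
    | cons g T => simp_all

theorem exists_completion_arrow (e : Total V) :
    ∃ q : Path e.right e.left, e.hom.toPath.comp q ∈ S.cycles e.left := by
  obtain ⟨a, C, hC, he⟩ := S.exists_mem_cycle e
  obtain ⟨x, y, rfl⟩ := Path.exists_eq_comp_comp_of_mem he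
  exact ⟨y.comp x, by simpa using comp_mem_cycles hC⟩

theorem exists_cycle {a : V} (ha : ∃ e : Total V, e.left = a ∨ e.right = a) :
    ∃ C : Path a a, C ∈ S.cycles a := by
  obtain ⟨e, rfl | rfl⟩ := ha
  · obtain ⟨q, hq⟩ := S.exists_completion_arrow e
    exact ⟨_, hq⟩
  · obtain ⟨q, hq⟩ := S.exists_completion_arrow e
    exact ⟨_, comp_mem_cycles hq⟩

/-- A path is completable if it is an initial part of a special cycle. -/
def Completable {a b : V} (p : Path a b) : Prop := ∃ q : Path b a, p.comp q ∈ S.cycles a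

theorem completable_of_infix {a b d : V} {p : Path a b} {C : Path d d} (hC : C ∈ S.cycles d)
    (h : p.arrows <:+: C.arrows) (hp : p.arrows ≠ []) : S.Completable p := by
  obtain ⟨x, y, rfl⟩ := Path.exists_eq_comp_comp_of_infix h hp
  exact ⟨y.comp x, by simpa using comp_mem_cycles hC⟩

variable (K : Type k) [Field K] [Fintype V]

variable {S} in
theorem type1_mem (hmult : ∀ (a : V) (C : Path a a), C ∈ S.cycles a → S.mult C = 1)
    {a : V} {C C' : Path a a} (hC : C ∈ S.cycles a) (hC' : C' ∈ S.cycles a) :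
    PathAlgebra.ofPath K C - PathAlgebra.ofPath K C' ∈ S.ideal K := by
  refine TwoSidedIdeal.subset_span (Or.inl (Or.inl ⟨a, C, C', hC, hC', ?_⟩))
  simp [hmult _ _ hC, hmult _ _ hC']

variable {S} in
theorem type2_mem (hmult : ∀ (a : V) (C : Path a a), C ∈ S.cycles a → S.mult C = 1)
    {a b : V} {e : a ⟶ b} {r : Path b a} (h : e.toPath.comp r ∈ S.cycles a) :
    PathAlgebra.ofPath K ((e.toPath.comp r).comp e.toPath) ∈ S.ideal K := by
  refine TwoSidedIdeal.subset_span (Or.inl (Or.inr ⟨a, _, ⟨a, b, e⟩, h, by simp, ?_⟩))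
  simp [hmult _ _ h, PathAlgebra.ofArrow, PathAlgebra.ofPath_mul_ofPath]

theorem type3_mem {a b c : V} {e : a ⟶ b} {f : b ⟶ c}
    (h : ¬ S.Completable (e.toPath.comp f.toPath)) :
    PathAlgebra.ofPath K (e.toPath.comp f.toPath) ∈ S.ideal K := by
  refine TwoSidedIdeal.subset_span (Or.inr ⟨a, b, c, e, f, ?_, rfl⟩)
  rintro ⟨d, C, hC, h'⟩
  exact h (S.completable_of_infix hC h' (by simp))

variable {S} in
/-- A path of positive length that is not an initial part of a special cycle lies in the ideal. -/
theorem ofPath_mem_ideal (hmult : ∀ (a : V) (C : Path a a), C ∈ S.cycles a → S.mult C = 1)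
    {a b : V} {p : Path a b} (hp : 0 < p.length) (h : ¬ S.Completable p) :
    PathAlgebra.ofPath K p ∈ S.ideal K := by
  induction p with
  | nil => simp at hp
  | @cons b c p e ih =>
    cases p with
    | nil => exact absurd (S.exists_completion_arrow ⟨_, _, e⟩) h
    | @cons b' _ p g =>
      -- The path is `p g e`. If `p g` or `g e` is not completable, induction or a Type 3 relation
      -- suffices. Otherwise `q` completes `p g`, `r` completes `g e`, and `q p = e r` because both
      -- sides complete `g`.
      by_cases h' : S.Completable (p.cons g)
      · obtain ⟨q, hq⟩ := h'
        by_cases hge : S.Completable (g.toPath.comp e.toPath)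
        · obtain ⟨r, hr⟩ := hge
          have hq' : g.toPath.comp (q.comp p) ∈ S.cycles b' := by
            rw [← Path.comp_assoc]
            refine comp_mem_cycles (p := p) (q := g.toPath.comp q) ?_
            rwa [← Path.comp_assoc]
          have key : q.comp p = e.toPath.comp r :=
            completion_unique (by simp) hq' (by rwa [← Path.comp_assoc])
          -- If `q` is trivial, `p g` is a special cycle with first arrow `e`, and Type 2 applies.
          -- Otherwise `q` begins with `e`, and the rest of `q` completes `p g e`, contrary to
          -- assumption.
          rcases Nat.eq_zero_or_pos q.length with h0 | h0
          · obtain rfl := Path.eq_of_length_zero q h0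
            obtain rfl := Path.eq_nil_of_length_zero q h0
            rw [Path.nil_comp] at key
            subst key
            exact type2_mem K hmult (r := r.cons g) hq
          · obtain ⟨c', f, q', rfl, -⟩ := (Path.length_ne_zero_iff_eq_comp q).1 h0.ne'
            have h₁ := congrArg Path.arrows key
            simp only [Path.arrows_comp, Path.arrows_toPath, List.cons_append,
              List.cons.injEq] at h₁
            cases h₁.1
            exact absurd ⟨q', by rwa [← Path.comp_assoc] at hq⟩ h
        · have := TwoSidedIdeal.mul_mem_left _ (PathAlgebra.ofPath K p) _ (S.type3_mem K hge)
          rwa [PathAlgebra.ofPath_mul_ofPath] at this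
      · have := TwoSidedIdeal.mul_mem_right _ _ (PathAlgebra.ofPath K e.toPath)
          (ih (by simp) h')
        rwa [PathAlgebra.ofPath_mul_ofPath] at this

end DefiningPair

/-! ### Linear and algebra maps on quotients by two-sided ideals -/

namespace TwoSidedIdeal

variable {K : Type*} {R : Type*} [Field K] [Ring R] [Algebra K R] (I : TwoSidedIdeal R)

theorem mkₐ_eq_zero_iff {x : R} : I.ringCon.mkₐ K x = 0 ↔ x ∈ I := by
  conv_rhs => rw [← ker_ringCon_mk' I, mem_ker]
  rfl

theorem smul_mem_of_mem (c : K) {x : R} (hx : x ∈ I) : c • x ∈ I := by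
  rw [Algebra.smul_def]
  exact I.mul_mem_left _ _ hx

/-- The linear map on a quotient that is induced by a linear map vanishing on the ideal. -/
def liftLinear {M : Type*} [AddCommGroup M] [Module K M] (f : R →ₗ[K] M)
    (h : ∀ x ∈ I, f x = 0) : I.ringCon.Quotient →ₗ[K] M where
  toFun := Quotient.lift f fun x y hxy =>
    sub_eq_zero.1 (by rw [← map_sub]; exact h _ ((I.rel_iff x y).1 hxy))
  map_add' := by
    rintro ⟨x⟩ ⟨y⟩
    exact map_add f x y
  map_smul' c := by
    rintro ⟨x⟩
    exact map_smul f c x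

/-- The algebra homomorphism on a quotient that is induced by one vanishing on the ideal. -/
def liftAlgHom {B : Type*} [Ring B] [Algebra K B] (f : R →ₐ[K] B) (h : ∀ x ∈ I, f x = 0) :
    I.ringCon.Quotient →ₐ[K] B :=
  I.ringCon.liftₐ f fun x y hxy =>
    sub_eq_zero.1 (by rw [← map_sub]; exact h _ ((I.rel_iff x y).1 hxy))

@[simp]
theorem liftAlgHom_mkₐ {B : Type*} [Ring B] [Algebra K B] (f : R →ₐ[K] B)
    (h : ∀ x ∈ I, f x = 0) (x : R) : I.liftAlgHom f h (I.ringCon.mkₐ K x) = f x := rfl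

end TwoSidedIdeal

/-! ### Maps out of path algebras -/

namespace PathAlgebra

variable {K : Type k} {V : Type u} [Field K] [Quiver.{v} V]

theorem linearMap_ext {M : Type*} [AddCommGroup M] [Module K M] {f g : PathAlgebra K V →ₗ[K] M}
    (h : ∀ (a b : V) (p : Path a b), f (ofPath K p) = g (ofPath K p)) : f = g :=
  (pathBasis K V).ext fun ⟨a, b, p⟩ => h a b p

variable (K) in
/-- The linear map on the path algebra with prescribed values on the paths. -/
def linearLift {M : Type*} [AddCommGroup M] [Module K M] (f : ∀ {a b : V}, Path a b → M) :
    PathAlgebra K V →ₗ[K] M :=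
  (pathBasis K V).constr K fun p => f p.2.2

@[simp]
theorem linearLift_ofPath {M : Type*} [AddCommGroup M] [Module K M]
    (f : ∀ {a b : V}, Path a b → M) {a b : V} (p : Path a b) :
    linearLift K f (ofPath K p) = f p :=
  (pathBasis K V).constr_basis K (fun p => f p.2.2) ⟨a, b, p⟩

/-- A bilinear identity in the path algebra may be checked on paths. -/
theorem bilin_ext {M : Type*} [AddCommGroup M] [Module K M]
    {f g : PathAlgebra K V →ₗ[K] PathAlgebra K V →ₗ[K] M}
    (h : ∀ (a b c d : V) (p : Path a b) (q : Path c d),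
      f (ofPath K p) (ofPath K q) = g (ofPath K p) (ofPath K q)) (x y : PathAlgebra K V) :
    f x y = g x y := by
  have : f = g := linearMap_ext fun a b p => linearMap_ext fun c d q => h a b c d p q
  rw [this]

variable [Fintype V] {B : Type*} [Ring B] [Algebra K B]

/-- The algebra homomorphism given by a linear map which is multiplicative on paths. -/
def algHomOfLinear (f : PathAlgebra K V →ₗ[K] B)
    (one : ∑ a : V, f (ofPath K (Path.nil : Path a a)) = 1)
    (comp : ∀ {a b c : V} (p : Path a b) (q : Path b c),
      f (ofPath K (p.comp q)) = f (ofPath K p) * f (ofPath K q))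
    (ne : ∀ {a b c d : V} (p : Path a b) (q : Path c d), b ≠ c →
      f (ofPath K p) * f (ofPath K q) = 0) : PathAlgebra K V →ₐ[K] B :=
  AlgHom.ofLinearMap f (by rw [one_def, map_sum, one]) fun x y => by
    refine bilin_ext (f := (LinearMap.mul K _).compr₂ f) (g := (LinearMap.mul K B).compl₁₂ f f)
      (fun a b c d p q => ?_) x y
    rcases eq_or_ne b c with rfl | h
    · simpa [ofPath_mul_ofPath] using comp p q
    · simpa [ofPath_mul_ofPath_of_ne _ _ h] using (ne p q h).symm

theorem algHom_ext {f g : PathAlgebra K V →ₐ[K] B}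
    (h : ∀ (a b : V) (p : Path a b), f (ofPath K p) = g (ofPath K p)) : f = g :=
  AlgHom.toLinearMap_injective (linearMap_ext h)

end PathAlgebra

/-! ### The quiver without the arrows of the cut -/

open PathAlgebra

/-- The quiver obtained from `V` by deleting the arrows in `D`. -/
@[ext]
structure CutQuiver {V : Type u} [Quiver.{v} V] (D : Set (Total V)) : Type u where
  /-- A vertex of `V` as a vertex of the quiver without the arrows in `D`. -/
  mk ::
  /-- The underlying vertex. -/
  vertex : V

namespace CutQuiver

variable {V : Type u} [Quiver.{v} V] (D : Set (Total V))

/-- The two quivers have the same vertices. -/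
def vertexEquiv : V ≃ CutQuiver D := ⟨mk, vertex, fun _ => rfl, fun _ => rfl⟩

instance : Quiver.{v} (CutQuiver D) :=
  ⟨fun a b => {e : a.vertex ⟶ b.vertex // (⟨a.vertex, b.vertex, e⟩ : Total V) ∉ D}⟩

instance [Fintype V] : Fintype (CutQuiver D) := Fintype.ofEquiv V (vertexEquiv D)

instance [∀ a b : V, Finite (a ⟶ b)] (a b : CutQuiver D) : Finite (a ⟶ b) :=
  Subtype.finite

/-- The inclusion of the quiver without the arrows in `D`. -/
abbrev incl : CutQuiver D ⥤q V where
  obj a := a.vertex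
  map e := e.1

variable {D}

theorem incl_map_notMem {a b : CutQuiver D} (e : a ⟶ b) :
    (⟨_, _, (incl D).map e⟩ : Total V) ∉ D := e.2

theorem exists_mapPath_eq {a b : V} (p : Path a b) (h : ∀ e ∈ p.arrows, e ∉ D) :
    ∃ p' : Path (mk a) (mk b), (incl D).mapPath p' = p := by
  induction p with
  | nil => exact ⟨Path.nil, rfl⟩
  | @cons b c p e ih =>
    obtain ⟨p', hp'⟩ := ih fun f hf => h f (by simp [hf])
    have he : (⟨b, c, e⟩ : Total V) ∉ D := h _ (by simp)
    exact ⟨p'.cons (⟨e, he⟩ : mk b ⟶ mk c), by rw [Prefunctor.mapPath_cons, hp']⟩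

theorem length_mapPath {a b : CutQuiver D} (p : Path a b) :
    ((incl D).mapPath p).length = p.length := by
  induction p with
  | nil => rfl
  | cons p f ih => simp [ih]

variable (K : Type k) [Field K]

variable (D) in
open Classical in
/-- A path of `V`, as an element of the path algebra of the quiver without the arrows in `D`. -/
def restrictPath {a : V} : ∀ {b : V}, Path a b → PathAlgebra K (CutQuiver D)
  | _, Path.nil => ofPath K (Path.nil : Path (mk a) (mk a))
  | _, @Path.cons _ _ _ b c p e =>
    if h : (⟨b, c, e⟩ : Total V) ∈ D then 0
    else restrictPath p * ofPath K (Hom.toPath (⟨e, h⟩ : mk b ⟶ mk c))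

theorem restrictPath_of_mem {a b : V} {p : Path a b} (h : ∃ e ∈ D, e ∈ p.arrows) :
    restrictPath D K p = 0 := by
  induction p with
  | nil => simp at h
  | @cons b c p e ih =>
    rw [restrictPath]
    split_ifs with he
    · rfl
    · obtain ⟨f, hf, hfp⟩ := h
      rw [ih, PathAlgebra.zero_mul]
      simp only [Path.arrows_cons, List.mem_append, List.mem_singleton] at hfp
      rcases hfp with hfp | rfl
      · exact ⟨f, hf, hfp⟩
      · exact absurd hf he

theorem restrictPath_mapPath {a b : CutQuiver D} (p : Path a b) :
    restrictPath D K ((incl D).mapPath p) = ofPath K p := by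
  induction p with
  | nil => rfl
  | @cons b c p e ih =>
    rw [Prefunctor.mapPath_cons, restrictPath, dif_neg (incl_map_notMem e), ih]
    exact ofPath_mul_ofPath p (Hom.toPath e)

theorem restrictPath_eq {a b : V} (p : Path a b) :
    ((∃ e ∈ D, e ∈ p.arrows) ∧ restrictPath D K p = 0) ∨
      ∃ p' : Path (mk a) (mk b), (incl D).mapPath p' = p ∧ restrictPath D K p = ofPath K p' := by
  by_cases h : ∃ e ∈ D, e ∈ p.arrows
  · exact Or.inl ⟨h, restrictPath_of_mem K h⟩
  · obtain ⟨p', hp'⟩ := exists_mapPath_eq p fun e he hD => h ⟨e, hD, he⟩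
    refine Or.inr ⟨p', hp', ?_⟩
    rw [← hp']
    exact restrictPath_mapPath K p'

variable [Fintype V]

variable (D) in
/-- The projection from the path algebra of `V` to the path algebra of the quiver without the
arrows in `D`, which kills the paths through `D`. -/
def restrict : PathAlgebra K V →ₐ[K] PathAlgebra K (CutQuiver D) :=
  algHomOfLinear (linearLift K (restrictPath D K))
    (by
      simp only [linearLift_ofPath, restrictPath, one_def]
      exact Fintype.sum_equiv (vertexEquiv D) _ _ fun a => rfl)
    (fun {a b c} p q => by
      simp only [linearLift_ofPath]
      rcases restrictPath_eq (D := D) K p with ⟨⟨e, he, hep⟩, hp⟩ | ⟨p', rfl, hp⟩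
      · rw [hp, zero_mul, restrictPath_of_mem K ⟨e, he, by simp [hep]⟩]
      · rcases restrictPath_eq (D := D) K q with ⟨⟨e, he, heq⟩, hq⟩ | ⟨q', rfl, hq⟩
        · rw [hq, mul_zero, restrictPath_of_mem K ⟨e, he, by simp [heq]⟩]
        · rw [hp, hq, ofPath_mul_ofPath, ← restrictPath_mapPath, Prefunctor.mapPath_comp])
    (fun {a b c d} p q h => by
      simp only [linearLift_ofPath]
      rcases restrictPath_eq (D := D) K p with ⟨-, hp⟩ | ⟨p', rfl, hp⟩
      · rw [hp, zero_mul]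
      · rcases restrictPath_eq (D := D) K q with ⟨-, hq⟩ | ⟨q', rfl, hq⟩
        · rw [hq, mul_zero]
        · rw [hp, hq]
          exact ofPath_mul_ofPath_of_ne _ _ fun h' => h (congrArg vertex h'))

@[simp]
theorem restrict_ofPath {a b : V} (p : Path a b) :
    restrict D K (ofPath K p) = restrictPath D K p :=
  linearLift_ofPath _ _

variable (D) in
/-- The inclusion of path algebras. -/
def extend : PathAlgebra K (CutQuiver D) →ₐ[K] PathAlgebra K V :=
  algHomOfLinear (linearLift K fun p => ofPath K ((incl D).mapPath p))
    (by
      simp only [linearLift_ofPath, one_def]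
      exact Fintype.sum_equiv (vertexEquiv D).symm _ _ fun a => rfl)
    (fun p q => by
      simp only [linearLift_ofPath, Prefunctor.mapPath_comp, ofPath_mul_ofPath])
    (fun p q h => by
      simp only [linearLift_ofPath]
      exact ofPath_mul_ofPath_of_ne _ _ fun h' => h (CutQuiver.ext h'))

@[simp]
theorem extend_ofPath {a b : CutQuiver D} (p : Path a b) :
    extend D K (ofPath K p) = ofPath K ((incl D).mapPath p) :=
  linearLift_ofPath (fun p => ofPath K ((incl D).mapPath p)) p

theorem restrict_extend (x : PathAlgebra K (CutQuiver D)) :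
    restrict D K (extend D K x) = x := by
  have : (restrict D K).comp (extend D K) = AlgHom.id K _ :=
    algHom_ext fun a b p => by simpa using restrictPath_mapPath K p
  exact DFunLike.congr_fun this x

theorem extend_restrict_of_mem {a b : V} {p : Path a b} (h : ∃ e ∈ D, e ∈ p.arrows) :
    extend D K (restrict D K (ofPath K p)) = 0 := by
  rw [restrict_ofPath, restrictPath_of_mem K h, map_zero]

theorem extend_restrict_of_notMem {a b : V} {p : Path a b} (h : ¬ ∃ e ∈ D, e ∈ p.arrows) :
    extend D K (restrict D K (ofPath K p)) = ofPath K p := by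
  rcases restrictPath_eq (D := D) K p with ⟨h', -⟩ | ⟨p', rfl, hp⟩
  · exact absurd h' h
  · rw [restrict_ofPath, hp, extend_ofPath]

end CutQuiver

/-! ### The almost gentle presentation of the cut algebra -/

namespace DefiningPair

variable {V : Type u} [Quiver.{v} V] (S : DefiningPair V) (K : Type k) [Field K]

section Cut

variable {S} {D : Set (Total V)}

theorem IsAdmissibleCut.exists_mem (hD : S.IsAdmissibleCut D) {a : V} {C : Path a a} (hC : C ∈ S.cycles a) :
    ∃ e ∈ D, e ∈ C.arrows :=
  (hD a C hC).exists

/-- A special cycle is not the composition of two paths through the cut. -/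
theorem IsAdmissibleCut.comp_notMem (hD : S.IsAdmissibleCut D) {a b : V}
    {p : Path a b} {q : Path b a}
    (hp : ∃ e ∈ D, e ∈ p.arrows) (hq : ∃ e ∈ D, e ∈ q.arrows) : p.comp q ∉ S.cycles a := by
  intro h
  obtain ⟨e, heD, he⟩ := hp
  obtain ⟨f, hfD, hf⟩ := hq
  have hn := S.simple _ h
  obtain rfl := (hD a _ h).unique ⟨heD, by simp [he]⟩ ⟨hfD, by simp [hf]⟩
  rw [Path.arrows_comp] at hn
  exact List.disjoint_of_nodup_append hn he hf

end Cut

variable {S} in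
-- A special cycle repeats no arrow. The bound gives the nilpotency half of admissibility.
theorem length_le_of_completable [Fintype (Total V)] {a b : V} {p : Path a b}
    (h : S.Completable p) : p.length ≤ Fintype.card (Total V) := by
  obtain ⟨q, hq⟩ := h
  have := (S.simple _ hq).length_le_card
  rw [Path.length_arrows, Path.length_comp] at this
  lia

instance finite_total [Finite V] [∀ a b : V, Finite (a ⟶ b)] : Finite (Total V) :=
  Finite.of_injective (β := Σ a b : V, a ⟶ b) (fun e => ⟨e.left, e.right, e.hom⟩) fun e f h => by
    obtain ⟨a, b, e⟩ := e
    obtain ⟨c, d, f⟩ := f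
    simp only [Sigma.mk.injEq] at h
    obtain ⟨rfl, h⟩ := h
    cases h
    rfl

theorem infix_of_completable {a b c : V} {e : a ⟶ b} {f : b ⟶ c}
    (h : S.Completable (e.toPath.comp f.toPath)) :
    ∃ (d : V) (C : Path d d), C ∈ S.cycles d ∧
      (e.toPath.comp f.toPath).arrows <:+: C.arrows := by
  obtain ⟨q, hq⟩ := h
  exact ⟨_, _, hq, [], q.arrows, by simp⟩

variable [Fintype V] {K}

variable {S} in
/-- To show that a two-sided ideal contains the ideal of a defining pair of multiplicity one, it
suffices to consider the generators. -/
theorem ideal_le (hmult : ∀ (a : V) (C : Path a a), C ∈ S.cycles a → S.mult C = 1)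
    {N : TwoSidedIdeal (PathAlgebra K V)}
    (h₁ : ∀ (a : V) (C C' : Path a a), C ∈ S.cycles a → C' ∈ S.cycles a →
      ofPath K C - ofPath K C' ∈ N)
    (h₂ : ∀ (a b : V) (C : Path a a) (e : a ⟶ b), C ∈ S.cycles a →
      ofPath K (C.comp e.toPath) ∈ N)
    (h₃ : ∀ (a b c : V) (e : a ⟶ b) (f : b ⟶ c), ¬ S.Completable (e.toPath.comp f.toPath) →
      ofPath K (e.toPath.comp f.toPath) ∈ N) : S.ideal K ≤ N := by
  refine TwoSidedIdeal.span_le.2 ?_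
  rintro x ((⟨a, C, C', hC, hC', rfl⟩ | ⟨a, C, ⟨a', b, e⟩, hC, he, rfl⟩) |
    ⟨a, b, c, e, f, hef, rfl⟩)
  · simpa [hmult _ _ hC, hmult _ _ hC'] using h₁ a C C' hC hC'
  · obtain rfl : a' = a := Path.arrows_head?_left he
    simpa [hmult _ _ hC, ofArrow, ofPath_mul_ofPath] using h₂ _ b C e hC
  · exact h₃ a b c e f (mt S.infix_of_completable hef)

variable {D : Set (Total V)}

theorem ideal_le_cutIdeal : S.ideal K ≤ S.cutIdeal K D := fun _ hx =>
  TwoSidedIdeal.subset_span (Or.inl hx)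

theorem ofPath_mem_cutIdeal {a b : V} {p : Path a b} (h : ∃ e ∈ D, e ∈ p.arrows) :
    ofPath K p ∈ S.cutIdeal K D := by
  obtain ⟨e, he, hep⟩ := h
  obtain ⟨x, y, rfl⟩ := Path.exists_eq_comp_comp_of_mem hep
  rw [← ofPath_mul_ofPath, ← ofPath_mul_ofPath]
  exact TwoSidedIdeal.mul_mem_left _ _ _ (TwoSidedIdeal.mul_mem_right _ _ _
    (TwoSidedIdeal.subset_span (Or.inr ⟨e, he, rfl⟩)))

variable {S} in
-- Every special cycle runs through `D`, so the relations of Types 1 and 2 are combinations of paths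
-- through `D`; only Type 3 needs a separate check.
theorem cutIdeal_le (hmult : ∀ (a : V) (C : Path a a), C ∈ S.cycles a → S.mult C = 1)
    (hD : S.IsAdmissibleCut D) {N : TwoSidedIdeal (PathAlgebra K V)}
    (h₁ : ∀ (a b : V) (p : Path a b), (∃ e ∈ D, e ∈ p.arrows) → ofPath K p ∈ N)
    (h₂ : ∀ (a b c : V) (e : a ⟶ b) (f : b ⟶ c), ¬ S.Completable (e.toPath.comp f.toPath) →
      ofPath K (e.toPath.comp f.toPath) ∈ N) : S.cutIdeal K D ≤ N := by
  refine TwoSidedIdeal.span_le.2 (Set.union_subset ?_ ?_)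
  · refine ideal_le hmult (fun a C C' hC hC' => ?_) (fun a b C e hC => ?_) h₂
    · exact N.sub_mem (h₁ _ _ _ (hD.exists_mem hC)) (h₁ _ _ _ (hD.exists_mem hC'))
    · obtain ⟨d, hdD, hd⟩ := hD.exists_mem hC
      exact h₁ _ _ _ ⟨d, hdD, by simp [hd]⟩
  · rintro _ ⟨e, he, rfl⟩
    exact h₁ _ _ _ ⟨e, he, by simp⟩

theorem sub_extend_restrict_mem (x : PathAlgebra K V) :
    x - CutQuiver.extend D K (CutQuiver.restrict D K x) ∈ S.cutIdeal K D := by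
  induction x using PathAlgebra.induction_on with
  | zero => simp
  | add x y hx hy =>
    rw [map_add, map_add, add_sub_add_comm]
    exact TwoSidedIdeal.add_mem _ hx hy
  | @single c a b p =>
    rw [map_smul, map_smul, ← smul_sub]
    refine TwoSidedIdeal.smul_mem_of_mem _ c ?_
    by_cases h : ∃ e ∈ D, e ∈ p.arrows
    · rw [CutQuiver.extend_restrict_of_mem K h, sub_zero]
      exact S.ofPath_mem_cutIdeal h
    · rw [CutQuiver.extend_restrict_of_notMem K h, sub_self]
      exact TwoSidedIdeal.zero_mem _

section Gentle

variable (K D)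

/-- The paths of length two outside of the cut that do not lie on a special cycle. -/
def gentleRelations : Set (AnyPath (CutQuiver D)) :=
  {p | p.2.2.length = 2 ∧ ¬ S.Completable ((CutQuiver.incl D).mapPath p.2.2)}

/-- The ideal of the almost gentle presentation of the cut algebra. -/
def gentleIdeal : TwoSidedIdeal (PathAlgebra K (CutQuiver D)) :=
  TwoSidedIdeal.span (ofAnyPath K '' S.gentleRelations D)

variable {K D S}

/-- The image lies in I_Λ itself, not merely in the cut ideal. The sharper containment is needed to
compute the kernel of the map to the trivial extension. -/
theorem extend_mem_ideal
    (hmult : ∀ (a : V) (C : Path a a), C ∈ S.cycles a → S.mult C = 1) {x : PathAlgebra K (CutQuiver D)} (hx : x ∈ S.gentleIdeal K D) :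
    CutQuiver.extend D K x ∈ S.ideal K := by
  have : S.gentleIdeal K D ≤ (S.ideal K).comap (CutQuiver.extend D K) := by
    refine TwoSidedIdeal.span_le.2 ?_
    rintro _ ⟨⟨a, b, p⟩, ⟨hp, hc⟩, rfl⟩
    refine (TwoSidedIdeal.mem_comap _).2 ?_
    change CutQuiver.extend D K (ofPath K p) ∈ _
    rw [CutQuiver.extend_ofPath]
    exact ofPath_mem_ideal K hmult (by rw [CutQuiver.length_mapPath]; exact hp ▸ two_pos) hc
  exact (TwoSidedIdeal.mem_comap _).1 (this hx)

theorem restrict_mem_gentleIdeal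
    (hmult : ∀ (a : V) (C : Path a a), C ∈ S.cycles a → S.mult C = 1) (hD : S.IsAdmissibleCut D) {x : PathAlgebra K V}
    (hx : x ∈ S.cutIdeal K D) : CutQuiver.restrict D K x ∈ S.gentleIdeal K D := by
  have : S.cutIdeal K D ≤ (S.gentleIdeal K D).comap (CutQuiver.restrict D K) := by
    refine cutIdeal_le hmult hD (fun a b p hp => ?_) (fun a b c e f hef => ?_)
    · rw [TwoSidedIdeal.mem_comap, CutQuiver.restrict_ofPath, CutQuiver.restrictPath_of_mem K hp]
      exact TwoSidedIdeal.zero_mem _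
    · rw [TwoSidedIdeal.mem_comap, CutQuiver.restrict_ofPath]
      rcases CutQuiver.restrictPath_eq (D := D) K (e.toPath.comp f.toPath) with
        ⟨-, h⟩ | ⟨p, hp, h⟩
      · rw [h]
        exact TwoSidedIdeal.zero_mem _
      · rw [h]
        refine TwoSidedIdeal.subset_span ⟨⟨_, _, p⟩, ⟨?_, ?_⟩, rfl⟩
        · rw [← CutQuiver.length_mapPath, hp]
          rfl
        · rwa [hp]
  exact (TwoSidedIdeal.mem_comap _).1 (this hx)

/-- The cut algebra is the quotient of the path algebra of the quiver without the arrows in the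
cut by the ideal generated by the paths of length two that do not lie on a special cycle. -/
def cutAlgebraEquiv
    (hmult : ∀ (a : V) (C : Path a a), C ∈ S.cycles a → S.mult C = 1) (hD : S.IsAdmissibleCut D) :
    S.cutAlgebra K D ≃ₐ[K] (S.gentleIdeal K D).ringCon.Quotient :=
  AlgEquiv.ofAlgHom
    ((S.cutIdeal K D).liftAlgHom
      (((S.gentleIdeal K D).ringCon.mkₐ K).comp (CutQuiver.restrict D K))
      fun x hx => (TwoSidedIdeal.mkₐ_eq_zero_iff (K := K) _).2 (restrict_mem_gentleIdeal hmult hD hx))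
    ((S.gentleIdeal K D).liftAlgHom
      (((S.cutIdeal K D).ringCon.mkₐ K).comp (CutQuiver.extend D K))
      fun x hx => (TwoSidedIdeal.mkₐ_eq_zero_iff (K := K) _).2
        (S.ideal_le_cutIdeal (extend_mem_ideal hmult hx)))
    (RingCon.Quotient.hom_extₐ (AlgHom.ext fun x => by
      change (S.gentleIdeal K D).ringCon.mkₐ K
        (CutQuiver.restrict D K (CutQuiver.extend D K x)) = _
      rw [CutQuiver.restrict_extend]
      rfl))
    (RingCon.Quotient.hom_extₐ (AlgHom.ext fun x => by
      change (S.cutIdeal K D).ringCon.mkₐ K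
        (CutQuiver.extend D K (CutQuiver.restrict D K x)) = (S.cutIdeal K D).ringCon.mkₐ K x
      rw [eq_comm, ← sub_eq_zero, ← map_sub, TwoSidedIdeal.mkₐ_eq_zero_iff]
      exact S.sub_extend_restrict_mem x))

theorem isGeneratedByPathsOfLengthTwo_gentleIdeal :
    IsGeneratedByPathsOfLengthTwo (S.gentleIdeal K D) :=
  ⟨_, fun _ hp => hp.1, rfl⟩

theorem _root_.PathAlgebra.mem_span_of_generated_length_two {I : TwoSidedIdeal (PathAlgebra K V)}
    (hI : IsGeneratedByPathsOfLengthTwo I) {x : PathAlgebra K V} (hx : x ∈ I) :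
    x ∈ Submodule.span K (ofAnyPath K '' {p : AnyPath V | 2 ≤ p.2.2.length}) := by
  obtain ⟨R, hR, rfl⟩ := hI
  have key : ∀ {a b c d : V} (p : Path a b) (q : Path c d), 2 ≤ p.length + q.length →
      ofPath K p * ofPath K q ∈
        Submodule.span K (ofAnyPath K '' {p : AnyPath V | 2 ≤ p.2.2.length}) := by
    intro a b c d p q h
    rcases eq_or_ne b c with rfl | hbc
    · rw [ofPath_mul_ofPath]
      exact Submodule.subset_span ⟨⟨_, _, p.comp q⟩, by simpa using h, rfl⟩
    · rw [ofPath_mul_ofPath_of_ne _ _ hbc]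
      exact Submodule.zero_mem _
  induction hx using TwoSidedIdeal.span_induction with
  | mem x hx =>
    obtain ⟨p, hp, rfl⟩ := hx
    exact Submodule.subset_span ⟨p, (hR p hp).ge, rfl⟩
  | zero => exact Submodule.zero_mem _
  | add x y _ _ hx hy => exact Submodule.add_mem _ hx hy
  | neg x _ hx => exact Submodule.neg_mem _ hx
  | left_absorb y x h₀ hx =>
    clear h₀
    induction y using PathAlgebra.induction_on with
    | zero => simp
    | add y y' h h' => rw [add_mul]; exact Submodule.add_mem _ h h'
    | single c q =>
      rw [smul_mul_assoc]
      refine Submodule.smul_mem _ c ?_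
      induction hx using Submodule.span_induction with
      | mem x hx =>
        obtain ⟨⟨_, _, p⟩, hp, rfl⟩ := hx
        exact key q p (le_add_left hp)
      | zero => simp
      | add x x' _ _ h h' => rw [mul_add]; exact Submodule.add_mem _ h h'
      | smul c x _ h => rw [mul_smul_comm]; exact Submodule.smul_mem _ c h
  | right_absorb y x h₀ hx =>
    clear h₀
    induction y using PathAlgebra.induction_on with
    | zero => simp
    | add y y' h h' => rw [mul_add]; exact Submodule.add_mem _ h h'
    | single c q =>
      rw [mul_smul_comm]
      refine Submodule.smul_mem _ c ?_
      induction hx using Submodule.span_induction with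
      | mem x hx =>
        obtain ⟨⟨_, _, p⟩, hp, rfl⟩ := hx
        exact key p q (le_add_right hp)
      | zero => simp
      | add x x' _ _ h h' => rw [add_mul]; exact Submodule.add_mem _ h h'
      | smul c x _ h => rw [smul_mul_assoc]; exact Submodule.smul_mem _ c h

theorem isAdmissible_gentleIdeal
    (hmult : ∀ (a : V) (C : Path a a), C ∈ S.cycles a → S.mult C = 1) [∀ a b : V, Finite (a ⟶ b)] (hD : S.IsAdmissibleCut D) :
    IsAdmissible (S.gentleIdeal K D) := by
  have := Fintype.ofFinite (Total V)
  refine ⟨⟨Fintype.card (Total V) + 1, ?_⟩, fun x hx =>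
    mem_span_of_generated_length_two isGeneratedByPathsOfLengthTwo_gentleIdeal hx⟩
  rintro ⟨a, b, p⟩ hp
  change _ ≤ p.length at hp
  change ofPath K p ∈ _
  -- A path longer than the number of arrows of `V` is not completable, so its image in the larger
  -- quiver lies in I_Λ; restriction brings this membership back.
  rw [← CutQuiver.restrict_extend K (ofPath K p), CutQuiver.extend_ofPath]
  refine restrict_mem_gentleIdeal hmult hD (S.ideal_le_cutIdeal
    (ofPath_mem_ideal K hmult (by rw [CutQuiver.length_mapPath]; lia) fun h => ?_))
  have := length_le_of_completable h
  rw [CutQuiver.length_mapPath] at this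
  lia

/-- A product of arrows outside the ideal is composable and completable. Thus `b` must be the second
arrow of the only special cycle that starts with `a`, and `c`, after a rotation, its last arrow. -/
theorem isSpecialMultiserialIdeal_gentleIdeal :
    IsSpecialMultiserialIdeal (S.gentleIdeal K D) := by
  have key : ∀ a b : Total (CutQuiver D), ofArrow K a * ofArrow K b ∉ S.gentleIdeal K D →
      ∃ (x y z : CutQuiver D) (e : x ⟶ y) (f : y ⟶ z), a = ⟨x, y, e⟩ ∧ b = ⟨y, z, f⟩ ∧
        S.Completable (((CutQuiver.incl D).map e).toPath.comp
          ((CutQuiver.incl D).map f).toPath) := by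
    rintro ⟨a, b, e⟩ ⟨c, d, f⟩ h
    simp only [ofArrow] at h
    rcases eq_or_ne b c with rfl | hbc
    · refine ⟨_, _, _, e, f, rfl, rfl, ?_⟩
      by_contra hc
      rw [ofPath_mul_ofPath] at h
      exact h (TwoSidedIdeal.subset_span ⟨⟨_, _, e.toPath.comp f.toPath⟩, ⟨rfl, hc⟩, rfl⟩)
    · rw [ofPath_mul_ofPath_of_ne _ _ hbc] at h
      exact absurd (TwoSidedIdeal.zero_mem _) h
  refine ⟨fun a b b' hb hb' => ?_, fun a c c' hc hc' => ?_⟩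
  · obtain ⟨x, y, z, e, f, rfl, rfl, q, hq⟩ := key a b hb
    obtain ⟨_, _, z', _, f', h, rfl, q', hq'⟩ := key _ b' hb'
    cases h
    rw [Path.comp_assoc] at hq hq'
    have := congrArg Path.arrows (completion_unique (by simp) hq hq')
    simp only [Path.arrows_comp, Path.arrows_toPath, List.cons_append, List.cons.injEq,
      Total.mk.injEq] at this
    obtain ⟨⟨-, h₁, h₂⟩, -⟩ := this
    obtain rfl := CutQuiver.ext h₁
    rw [Subtype.ext (eq_of_heq h₂)]
  · obtain ⟨x, y, z, e, f, rfl, rfl, q, hq⟩ := key c a hc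
    obtain ⟨x', _, _, e', _, rfl, h, q', hq'⟩ := key c' _ hc'
    cases h
    rw [Path.comp_assoc] at hq hq'
    replace hq := comp_mem_cycles hq
    replace hq' := comp_mem_cycles hq'
    rw [Path.comp_assoc] at hq hq'
    have := congrArg Path.arrows (completion_unique (by simp) hq hq')
    rw [Path.arrows_comp, Path.arrows_comp] at this
    have := (List.append_inj' this rfl).2
    simp only [Path.arrows_toPath, List.cons.injEq, Total.mk.injEq] at this
    obtain ⟨⟨h₁, -, h₂⟩, -⟩ := this
    obtain rfl := CutQuiver.ext h₁
    rw [Subtype.ext (eq_of_heq h₂)]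

theorem isAlmostGentle_cutAlgebra
    (hmult : ∀ (a : V) (C : Path a a), C ∈ S.cycles a → S.mult C = 1) [∀ a b : V, Finite (a ⟶ b)] (hD : S.IsAdmissibleCut D) :
    IsAlmostGentle.{k, u, v} K (S.cutAlgebra K D) :=
  ⟨CutQuiver D, inferInstance, inferInstance, inferInstance, S.gentleIdeal K D,
    isAdmissible_gentleIdeal hmult hD, isGeneratedByPathsOfLengthTwo_gentleIdeal,
    isSpecialMultiserialIdeal_gentleIdeal, .of_algEquiv K (cutAlgebraEquiv hmult hD)⟩

end Gentle

end DefiningPair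

/-! ### The symmetric trace form and the part through the cut -/

namespace DefiningPair

variable {V : Type u} [Quiver.{v} V] (S : DefiningPair V) (K : Type k) [Field K]

section TraceForm

open Classical in
/-- The linear form on the path algebra that is one on the special cycles and zero on all other
paths. -/
def traceForm : PathAlgebra K V →ₗ[K] K :=
  linearLift K fun {a b} p =>
    if ∃ C ∈ S.cycles a, (⟨a, b, p⟩ : AnyPath V) = ⟨a, a, C⟩ then 1 else 0

variable {S} in
theorem traceForm_of_mem {a : V} {C : Path a a} (hC : C ∈ S.cycles a) :
    S.traceForm K (ofPath K C) = 1 := by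
  rw [traceForm, linearLift_ofPath, if_pos ⟨C, hC, rfl⟩]

theorem traceForm_eq_zero_or {a b : V} (p : Path a b) :
    S.traceForm K (ofPath K p) = 0 ∨
      ∃ C ∈ S.cycles a, (⟨a, b, p⟩ : AnyPath V) = ⟨a, a, C⟩ := by
  rw [traceForm, linearLift_ofPath]
  split_ifs with h
  · exact Or.inr h
  · exact Or.inl rfl

/-- A nonzero trace forces `q` to be a completion of `p`. The equality is stated in `AnyPath` so
that case analysis on it identifies the end points as well. -/
theorem traceForm_mul_eq_zero_or {a b c d : V} (p : Path a b) (q : Path c d) :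
    S.traceForm K (ofPath K p * ofPath K q) = 0 ∨
      ∃ q' : Path b a, (⟨c, d, q⟩ : AnyPath V) = ⟨b, a, q'⟩ ∧ p.comp q' ∈ S.cycles a := by
  rcases eq_or_ne b c with rfl | h
  · rw [ofPath_mul_ofPath]
    refine (S.traceForm_eq_zero_or K _).imp_right ?_
    rintro ⟨C, hC, h⟩
    cases h
    exact ⟨q, rfl, hC⟩
  · rw [ofPath_mul_ofPath_of_ne _ _ h, map_zero]
    exact Or.inl rfl

/-- Symmetry of the form is the closure of the special cycles under rotation. -/
theorem traceForm_ofPath_mul_comm {a b c d : V} (p : Path a b) (q : Path c d) :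
    S.traceForm K (ofPath K p * ofPath K q) = S.traceForm K (ofPath K q * ofPath K p) := by
  rcases S.traceForm_mul_eq_zero_or K p q with h | ⟨q', h, hq⟩
  · rcases S.traceForm_mul_eq_zero_or K q p with h' | ⟨p', h', hp⟩
    · rw [h, h']
    · cases h'
      rw [ofPath_mul_ofPath, ofPath_mul_ofPath, traceForm_of_mem K hp,
        traceForm_of_mem K (comp_mem_cycles hp)]
  · cases h
    rw [ofPath_mul_ofPath, ofPath_mul_ofPath, traceForm_of_mem K hq,
      traceForm_of_mem K (comp_mem_cycles hq)]

end TraceForm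

theorem finite_completable [Finite V] [∀ a b : V, Finite (a ⟶ b)] :
    {p : AnyPath V | S.Completable p.2.2}.Finite := by
  have := Fintype.ofFinite (Total V)
  classical
  have hn : ∀ p : {p : AnyPath V | S.Completable p.2.2}, p.1.2.2.arrows.Nodup := by
    rintro ⟨p, q, hq⟩
    have := S.simple _ hq
    rw [Path.arrows_comp] at this
    exact this.of_append_left
  -- The initial vertex is recorded along with the arrows because all trivial paths have the empty
  -- list.
  refine Set.finite_coe_iff.1 (Finite.of_injective (β := V × {l : List (Total V) // l.Nodup})
    (fun p => (p.1.1, ⟨p.1.2.2.arrows, hn p⟩)) ?_)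
  rintro ⟨⟨a, b, p⟩, hp⟩ ⟨⟨a', b', q⟩, hq⟩ h
  simp only [Prod.mk.injEq, Subtype.mk.injEq] at h
  obtain ⟨rfl, h⟩ := h
  refine Subtype.ext ?_
  cases p with
  | nil =>
    cases q with
    | nil => rfl
    | cons q f => simp at h
  | cons p e => exact Path.sigma_eq_of_arrows_eq h (by simp)

theorem length_pos_of_cut {D : Set (Total V)} {a b : V} {p : Path a b} (h : ∃ e ∈ D, e ∈ p.arrows) :
    0 < p.length := by
  obtain ⟨e, -, he⟩ := h
  rw [← Path.length_arrows]
  exact List.length_pos_of_mem he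

variable [Fintype V]

theorem traceForm_mul_comm (x y : PathAlgebra K V) :
    S.traceForm K (x * y) = S.traceForm K (y * x) := by
  have h := bilin_ext (f := (LinearMap.mul K (PathAlgebra K V)).compr₂ (S.traceForm K))
    (g := (LinearMap.mul K (PathAlgebra K V)).flip.compr₂ (S.traceForm K))
    (fun _ _ _ _ p q => by simpa using S.traceForm_ofPath_mul_comm K p q) x y
  simpa using h

variable (D : Set (Total V))

/-- The projection of the path algebra onto the span of the paths through `D`. -/
def _root_.PathAlgebra.cutPart : PathAlgebra K V →ₗ[K] PathAlgebra K V :=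
  LinearMap.id - ((CutQuiver.extend D K).comp (CutQuiver.restrict D K)).toLinearMap

variable {K D S}

theorem _root_.PathAlgebra.cutPart_apply (x : PathAlgebra K V) :
    cutPart K D x = x - CutQuiver.extend D K (CutQuiver.restrict D K x) := rfl

theorem _root_.PathAlgebra.cutPart_of_mem {a b : V} {p : Path a b}
    (h : ∃ e ∈ D, e ∈ p.arrows) : cutPart K D (ofPath K p) = ofPath K p := by
  rw [cutPart_apply, CutQuiver.extend_restrict_of_mem K h, sub_zero]

theorem _root_.PathAlgebra.cutPart_of_notMem {a b : V} {p : Path a b}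
    (h : ¬ ∃ e ∈ D, e ∈ p.arrows) : cutPart K D (ofPath K p) = 0 := by
  rw [cutPart_apply, CutQuiver.extend_restrict_of_notMem K h, sub_self]

/-- The range of `cutPart` is the kernel of `restrict`, a two-sided ideal on which `cutPart` is the
identity. -/
theorem _root_.PathAlgebra.cutPart_cutPart_mul (x y : PathAlgebra K V) :
    cutPart K D (cutPart K D x * y) = cutPart K D x * y := by
  simp [cutPart_apply, CutQuiver.restrict_extend]

theorem _root_.PathAlgebra.cutPart_mul_cutPart (x y : PathAlgebra K V) :
    cutPart K D (x * cutPart K D y) = x * cutPart K D y := by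
  simp [cutPart_apply, CutQuiver.restrict_extend]

theorem _root_.PathAlgebra.cutPart_cutPart (x : PathAlgebra K V) :
    cutPart K D (cutPart K D x) = cutPart K D x := by
  simpa using cutPart_cutPart_mul (D := D) x 1

theorem _root_.PathAlgebra.cutPart_mul (x y : PathAlgebra K V) :
    cutPart K D (x * y) =
      x * cutPart K D y + cutPart K D x * y - cutPart K D x * cutPart K D y := by
  simp only [cutPart_apply, map_mul]
  noncomm_ring

theorem cutPart_mem_cutIdeal (x : PathAlgebra K V) : cutPart K D x ∈ S.cutIdeal K D :=
  S.sub_extend_restrict_mem x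

theorem mkₐ_cutPart (x : PathAlgebra K V) :
    (S.cutIdeal K D).ringCon.mkₐ K (cutPart K D x) = 0 :=
  (TwoSidedIdeal.mkₐ_eq_zero_iff _).2 (cutPart_mem_cutIdeal x)

/-- A special cycle contains a single arrow of `D`, only once, so it is no product of two paths
through `D`; nor can it contain a non-completable path of length two. This makes the functional
φ(c(x) ·) descend to the cut algebra. -/
theorem traceForm_cutPart_mul_eq_zero
    (hmult : ∀ (a : V) (C : Path a a), C ∈ S.cycles a → S.mult C = 1)
    (hD : S.IsAdmissibleCut D) (x : PathAlgebra K V) {y : PathAlgebra K V}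
    (hy : y ∈ S.cutIdeal K D) : S.traceForm K (cutPart K D x * y) = 0 := by
  let N : TwoSidedIdeal (PathAlgebra K V) :=
    TwoSidedIdeal.mk' {y | ∀ x, S.traceForm K (cutPart K D x * y) = 0}
      (fun x => by simp)
      (fun h h' x => by rw [mul_add, map_add, h, h', add_zero])
      (fun h x => by rw [mul_neg, map_neg, h, neg_zero])
      -- The elements `y` annihilated by all cut parts form a two-sided ideal: `cutPart x * u` is
      -- again a cut part, and so is `u * cutPart x`, which arises when a right factor `u` is moved
      -- to the front by symmetry of the form.
      (fun {u y} h x => by rw [← mul_assoc, ← cutPart_cutPart_mul, h])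
      (fun {y u} h x => by
        rw [← mul_assoc, traceForm_mul_comm, ← mul_assoc, ← cutPart_mul_cutPart, h])
  have hN : ∀ {c d : V} (q : Path c d),
      (∀ (p : Path d c), (∃ e ∈ D, e ∈ p.arrows) → p.comp q ∉ S.cycles d) → ofPath K q ∈ N := by
    intro c d q hq
    refine (TwoSidedIdeal.mem_mk' ..).2 fun x => ?_
    refine LinearMap.congr_fun (f := (S.traceForm K).comp
      ((LinearMap.mulRight K (ofPath K q)).comp (cutPart K D))) (g := 0)
      (linearMap_ext fun a b p => ?_) x
    change S.traceForm K (cutPart K D (ofPath K p) * ofPath K q) = 0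
    by_cases hp : ∃ e ∈ D, e ∈ p.arrows
    · rw [cutPart_of_mem hp]
      refine (S.traceForm_mul_eq_zero_or K p q).resolve_right ?_
      rintro ⟨q', h, hpq⟩
      cases h
      exact hq p hp hpq
    · rw [cutPart_of_notMem hp, zero_mul, map_zero]
  refine (TwoSidedIdeal.mem_mk' ..).1 (cutIdeal_le hmult hD (N := N) (fun a b q hq => ?_)
    (fun a b c e f hef => ?_) hy) x
  · exact hN q fun p hp => hD.comp_notMem hp hq
  · exact hN _ fun p _ h => hef ⟨p, comp_mem_cycles h⟩

/-! ### The homomorphism to the trivial extension -/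

section Comparison

variable (hmult : ∀ (a : V) (C : Path a a), C ∈ S.cycles a → S.mult C = 1)
  (hD : S.IsAdmissibleCut D)

variable (K) in
/-- The functional on the cut algebra that is given by the trace form and the part of an element
in the span of the paths through the cut. -/
def dualPart : PathAlgebra K V →ₗ[K] DualBimodule K (S.cutAlgebra K D) where
  toFun x := (S.cutIdeal K D).liftLinear
    ((S.traceForm K).comp (LinearMap.mulLeft K (cutPart K D x)))
    fun _ hy => traceForm_cutPart_mul_eq_zero hmult hD x hy
  map_add' x y := DualBimodule.ext <| by
    rintro ⟨z⟩
    change S.traceForm K (cutPart K D (x + y) * z) =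
      S.traceForm K (cutPart K D x * z) + S.traceForm K (cutPart K D y * z)
    rw [map_add, add_mul, map_add]
  map_smul' c x := DualBimodule.ext <| by
    rintro ⟨z⟩
    change S.traceForm K (cutPart K D (c • x) * z) = c * S.traceForm K (cutPart K D x * z)
    rw [map_smul, smul_mul_assoc, map_smul, smul_eq_mul]

theorem dualPart_apply (x y : PathAlgebra K V) :
    dualPart K hmult hD x ((S.cutIdeal K D).ringCon.mkₐ K y) =
      S.traceForm K (cutPart K D x * y) := rfl

theorem dualPart_cutPart (x : PathAlgebra K V) :
    dualPart K hmult hD (cutPart K D x) = dualPart K hmult hD x := DualBimodule.ext <| by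
  rintro ⟨z⟩
  change S.traceForm K (cutPart K D (cutPart K D x) * z) = S.traceForm K (cutPart K D x * z)
  rw [cutPart_cutPart]

/-- Functionals on the cut algebra that agree on the paths are equal. -/
theorem dual_ext {f g : DualBimodule K (S.cutAlgebra K D)}
    (h : ∀ (a b : V) (p : Path a b), f ((S.cutIdeal K D).ringCon.mkₐ K (ofPath K p)) =
      g ((S.cutIdeal K D).ringCon.mkₐ K (ofPath K p))) : f = g := DualBimodule.ext <| by
  rintro ⟨z⟩
  exact LinearMap.congr_fun
    (f := LinearMap.comp (f : S.cutAlgebra K D →ₗ[K] K)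
      ((S.cutIdeal K D).ringCon.mkₐ K).toLinearMap)
    (g := LinearMap.comp (g : S.cutAlgebra K D →ₗ[K] K)
      ((S.cutIdeal K D).ringCon.mkₐ K).toLinearMap)
    (linearMap_ext h) z

variable (K) in
/-- The homomorphism from the path algebra to the trivial extension of the cut algebra. -/
def toTrivialExtension : PathAlgebra K V →ₐ[K] TrivialExtension K (S.cutAlgebra K D) :=
  AlgHom.ofLinearMap
    { toFun x := ((S.cutIdeal K D).ringCon.mkₐ K x, dualPart K hmult hD x)
      map_add' _ _ := TrivSqZeroExt.ext (map_add _ _ _) (map_add _ _ _)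
      map_smul' _ _ := TrivSqZeroExt.ext (map_smul _ _ _) (map_smul _ _ _) }
    (TrivSqZeroExt.ext (map_one _) <| by
      change dualPart K hmult hD 1 = 0
      rw [← dualPart_cutPart, cutPart_apply, map_one, map_one, sub_self, map_zero])
    (fun x y => by
      refine TrivSqZeroExt.ext (map_mul _ _ _) (DualBimodule.ext ?_)
      rintro ⟨z⟩
      -- This is the cross term of `cutPart_mul`. In the term with `x * cutPart y`, symmetry of the
      -- form moves `x` behind `z`, which is the left action on the functional of `y`.
      have h := traceForm_cutPart_mul_eq_zero hmult hD x
        (TwoSidedIdeal.mul_mem_right _ _ z (cutPart_mem_cutIdeal (S := S) (D := D) y))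
      have h' := S.traceForm_mul_comm K (cutPart K D y * z) x
      change S.traceForm K (cutPart K D (x * y) * z) =
          S.traceForm K (cutPart K D y * (z * x)) + S.traceForm K (cutPart K D x * (y * z))
      rw [cutPart_mul, sub_mul, map_sub, mul_assoc (cutPart K D x), h, sub_zero, add_mul,
        map_add, ← mul_assoc (cutPart K D y), h', mul_assoc, mul_assoc])

@[simp]
theorem fst_toTrivialExtension (x : PathAlgebra K V) :
    (toTrivialExtension K hmult hD x).fst = (S.cutIdeal K D).ringCon.mkₐ K x := rfl

@[simp]
theorem snd_toTrivialExtension (x : PathAlgebra K V) :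
    (toTrivialExtension K hmult hD x).snd = dualPart K hmult hD x := rfl

/-- Only the trivial path completes a special cycle. Hence all special cycles at a vertex define the
same functional, while a special cycle followed by an arrow, like a Type 3 path, has no completion
and defines the zero functional. -/
theorem toTrivialExtension_eq_zero {x : PathAlgebra K V} (hx : x ∈ S.ideal K) :
    toTrivialExtension K hmult hD x = 0 := by
  refine (TwoSidedIdeal.mem_ker _).1 (ideal_le hmult (N := TwoSidedIdeal.ker
    (toTrivialExtension K hmult hD)) (fun a C C' hC hC' => ?_) (fun a b C e hC => ?_)
    (fun a b c e f hef => ?_) hx)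
  · rw [TwoSidedIdeal.mem_ker]
    refine TrivSqZeroExt.ext ?_ (dual_ext fun c d q => ?_)
    · rw [fst_toTrivialExtension, TrivSqZeroExt.fst_zero, TwoSidedIdeal.mkₐ_eq_zero_iff]
      exact S.ideal_le_cutIdeal (type1_mem K hmult hC hC')
    · rw [snd_toTrivialExtension, TrivSqZeroExt.snd_zero, dualPart_apply, map_sub,
        cutPart_of_mem (hD.exists_mem hC), cutPart_of_mem (hD.exists_mem hC'), sub_mul, map_sub,
        DualBimodule.zero_apply, sub_eq_zero]
      have key : ∀ {C C' : Path a a}, C ∈ S.cycles a → C' ∈ S.cycles a →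
          S.traceForm K (ofPath K C * ofPath K q) ≠ 0 →
          S.traceForm K (ofPath K C * ofPath K q) =
            S.traceForm K (ofPath K C' * ofPath K q) := by
        intro C C' hC hC' h
        obtain ⟨q', hq', hCq⟩ := (S.traceForm_mul_eq_zero_or K C q).resolve_left h
        cases hq'
        obtain rfl := completion_unique (y := Path.nil) (S.length_pos C hC) hCq hC
        rw [ofPath_mul_ofPath, ofPath_mul_ofPath, Path.comp_nil, Path.comp_nil,
          traceForm_of_mem K hC, traceForm_of_mem K hC']
      by_cases h : S.traceForm K (ofPath K C * ofPath K q) = 0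
      · by_contra h'
        exact h' (key hC' hC fun h'' => h' (h.trans h''.symm)).symm
      · exact key hC hC' h
  · rw [TwoSidedIdeal.mem_ker]
    have hc : ∃ f ∈ D, f ∈ (C.comp e.toPath).arrows := by
      obtain ⟨d, hd, hdC⟩ := hD.exists_mem hC
      exact ⟨d, hd, by simp [hdC]⟩
    refine TrivSqZeroExt.ext ?_ (dual_ext fun c d q => ?_)
    · rw [fst_toTrivialExtension, TrivSqZeroExt.fst_zero, TwoSidedIdeal.mkₐ_eq_zero_iff]
      exact S.ofPath_mem_cutIdeal hc
    · rw [snd_toTrivialExtension, TrivSqZeroExt.snd_zero, dualPart_apply, cutPart_of_mem hc,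
        DualBimodule.zero_apply]
      refine (S.traceForm_mul_eq_zero_or K _ q).resolve_right ?_
      rintro ⟨q', -, h⟩
      rw [Path.comp_assoc] at h
      have := congrArg Path.length
        (completion_unique (y := Path.nil) (S.length_pos C hC) h hC)
      simp at this
  · rw [TwoSidedIdeal.mem_ker]
    refine TrivSqZeroExt.ext ?_ (dual_ext fun c d q => ?_)
    · rw [fst_toTrivialExtension, TrivSqZeroExt.fst_zero, TwoSidedIdeal.mkₐ_eq_zero_iff]
      exact S.ideal_le_cutIdeal (S.type3_mem K hef)
    · rw [snd_toTrivialExtension, TrivSqZeroExt.snd_zero, dualPart_apply,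
        DualBimodule.zero_apply]
      by_cases hc : ∃ d ∈ D, d ∈ (e.toPath.comp f.toPath).arrows
      · rw [cutPart_of_mem hc]
        refine (S.traceForm_mul_eq_zero_or K _ q).resolve_right ?_
        rintro ⟨q', -, h⟩
        exact hef ⟨q', h⟩
      · rw [cutPart_of_notMem hc, zero_mul, map_zero]

end Comparison

/-! ### The dual basis given by completions -/

section DualBasis

variable (S)

variable (K D) in
open Classical in
/-- A chosen completion of a path to a special cycle, if it runs through `D`, and zero
otherwise. -/
def dualPath (p : AnyPath V) : PathAlgebra K V :=
  if h : S.Completable p.2.2 then cutPart K D (ofPath K h.choose) else 0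

theorem cutPart_dualPath (p : AnyPath V) :
    cutPart K D (S.dualPath K D p) = S.dualPath K D p := by
  rw [dualPath]
  split_ifs
  · exact cutPart_cutPart _
  · exact map_zero _

variable {S}

/-- The arrow of `D` on the completed cycle is not on `p`, so it lies on the chosen completion,
which `cutPart` then leaves unchanged. For trivial `p` the choice is an arbitrary special cycle at
the vertex. -/
theorem exists_dualPath_eq (hD : S.IsAdmissibleCut D) {a b : V} {p : Path a b}
    (hp : S.Completable p) (hc : ¬ ∃ e ∈ D, e ∈ p.arrows) :
    ∃ q : Path b a, p.comp q ∈ S.cycles a ∧ (∃ e ∈ D, e ∈ q.arrows) ∧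
      S.dualPath K D ⟨a, b, p⟩ = ofPath K q := by
  obtain ⟨e, he, heC⟩ := hD.exists_mem hp.choose_spec
  rw [Path.arrows_comp, List.mem_append] at heC
  have hc' : ∃ e ∈ D, e ∈ hp.choose.arrows :=
    ⟨e, he, heC.resolve_left fun h => hc ⟨e, he, h⟩⟩
  exact ⟨_, hp.choose_spec, hc', (dif_pos hp).trans (cutPart_of_mem hc')⟩

/-- Orthogonality of the dual basis. Unique completion is applied to the chosen completion of `p`,
which has positive length as it runs through `D`; so `p` itself may be trivial. -/
theorem traceForm_dualPath_mul_of_ne {a b : V} {p : AnyPath V} {q : Path a b}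
    (h : p ≠ ⟨a, b, q⟩) : S.traceForm K (S.dualPath K D p * ofPath K q) = 0 := by
  obtain ⟨c, d, p⟩ := p
  rw [dualPath]
  split_ifs with hp
  · by_cases hc : ∃ e ∈ D, e ∈ hp.choose.arrows
    · rw [cutPart_of_mem hc]
      refine (S.traceForm_mul_eq_zero_or K _ q).resolve_right ?_
      rintro ⟨q', hq, h'⟩
      cases hq
      obtain rfl : p = q' := completion_unique (length_pos_of_cut hc)
        (comp_mem_cycles hp.choose_spec) h'
      exact h rfl
    · rw [cutPart_of_notMem hc, zero_mul, map_zero]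
  · rw [zero_mul, map_zero]

end DualBasis

/-! ### Kernel and image of the homomorphism -/

section Bijective

variable (hmult : ∀ (a : V) (C : Path a a), C ∈ S.cycles a → S.mult C = 1)
  (hD : S.IsAdmissibleCut D)

/-- The hypothesis `hV` makes trivial paths completable. An isolated vertex would contribute
dimension one to Λ but two to the trivial extension. -/
theorem completable_or_mem_ideal (hV : ∀ a : V, ∃ e : Total V, e.left = a ∨ e.right = a)
    (hmult : ∀ (a : V) (C : Path a a), C ∈ S.cycles a → S.mult C = 1) {a b : V} (p : Path a b) :
    S.Completable p ∨ ofPath K p ∈ S.ideal K := by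
  by_cases h : S.Completable p
  · exact Or.inl h
  · refine Or.inr (ofPath_mem_ideal K hmult (Nat.pos_of_ne_zero fun h0 => h ?_) h)
    obtain rfl := Path.eq_of_length_zero p h0
    obtain rfl := Path.eq_nil_of_length_zero p h0
    obtain ⟨C, hC⟩ := S.exists_cycle (hV a)
    exact ⟨C, by rwa [Path.nil_comp]⟩

theorem dual_eq_dualPart_sum [∀ a b : V, Finite (a ⟶ b)]
    (hV : ∀ a : V, ∃ e : Total V, e.left = a ∨ e.right = a)
    (f : DualBimodule K (S.cutAlgebra K D)) :
    dualPart K hmult hD (∑ p ∈ S.finite_completable.toFinset,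
      f ((S.cutIdeal K D).ringCon.mkₐ K (ofAnyPath K p)) • S.dualPath K D p) = f := by
  refine dual_ext fun a b q => ?_
  rw [dualPart_apply]
  by_cases hq : ofPath K q ∈ S.cutIdeal K D
  · rw [traceForm_cutPart_mul_eq_zero hmult hD _ hq,
      (TwoSidedIdeal.mkₐ_eq_zero_iff (K := K) _).2 hq, map_zero]
  have hc : ¬ ∃ e ∈ D, e ∈ q.arrows := fun h => hq (S.ofPath_mem_cutIdeal h)
  have hqc : S.Completable q := (completable_or_mem_ideal hV hmult q).resolve_right fun h =>
    hq (S.ideal_le_cutIdeal h)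
  simp only [map_sum, map_smul, cutPart_dualPath, Finset.sum_mul, smul_mul_assoc]
  rw [Finset.sum_eq_single ⟨a, b, q⟩]
  · obtain ⟨r, hr, -, h⟩ := exists_dualPath_eq (K := K) hD hqc hc
    rw [h, ofPath_mul_ofPath, traceForm_of_mem K (comp_mem_cycles hr), smul_eq_mul, mul_one]
    rfl
  · intro p _ hp
    rw [traceForm_dualPath_mul_of_ne hp, smul_zero]
  · intro h
    exact absurd ((Set.Finite.mem_toFinset S.finite_completable).2 hqc) h

/-- Modulo I_Λ, the cut part of an element is recovered from its functional by expansion in the dual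
basis; this is the source of injectivity. -/
theorem cutPart_sub_sum_mem_ideal [∀ a b : V, Finite (a ⟶ b)]
    (hmult : ∀ (a : V) (C : Path a a), C ∈ S.cycles a → S.mult C = 1)
    (hD : S.IsAdmissibleCut D) (x : PathAlgebra K V) :
    cutPart K D x - ∑ p ∈ S.finite_completable.toFinset,
      S.traceForm K (cutPart K D x * ofAnyPath K p) • S.dualPath K D p ∈ S.ideal K := by
  induction x using PathAlgebra.induction_on with
  | zero => simp
  | add x y hx hy =>
    simp only [map_add, add_mul, add_smul, Finset.sum_add_distrib]
    rw [add_sub_add_comm]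
    exact TwoSidedIdeal.add_mem _ hx hy
  | @single c a b p =>
    simp only [map_smul, smul_mul_assoc, smul_assoc]
    rw [← Finset.smul_sum, ← smul_sub]
    refine TwoSidedIdeal.smul_mem_of_mem _ c ?_
    by_cases hc : ∃ e ∈ D, e ∈ p.arrows
    swap
    · simp [cutPart_of_notMem hc]
    rw [cutPart_of_mem hc]
    by_cases hp : S.Completable p
    · obtain ⟨r, hr⟩ := hp
      have hrc : ¬ ∃ e ∈ D, e ∈ r.arrows := fun h => hD.comp_notMem hc h hr
      obtain ⟨s, hs, -, h⟩ := exists_dualPath_eq (K := K) hD ⟨p, comp_mem_cycles hr⟩ hrc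
      rw [Finset.sum_eq_single ⟨b, a, r⟩]
      · change _ - S.traceForm K (ofPath K p * ofPath K r) • _ ∈ _
        rw [ofPath_mul_ofPath, traceForm_of_mem K hr, one_smul, h]
        -- Here `r` completes `p`, and `s` is the chosen completion of `r`. If `r` is trivial, `p`
        -- and `s` may be different special cycles at one vertex, which Type 1 identifies; otherwise
        -- `s = p`.
        rcases Nat.eq_zero_or_pos r.length with h0 | h0
        · obtain rfl := Path.eq_of_length_zero r h0
          obtain rfl := Path.eq_nil_of_length_zero r h0
          rw [Path.comp_nil] at hr
          rw [Path.nil_comp] at hs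
          exact type1_mem K hmult hr hs
        · rw [completion_unique h0 hs (comp_mem_cycles hr), sub_self]
          exact TwoSidedIdeal.zero_mem _
      · rintro ⟨c, d, q⟩ - hq
        change S.traceForm K (ofPath K p * ofPath K q) • _ = _
        rw [(S.traceForm_mul_eq_zero_or K p q).resolve_right, zero_smul]
        rintro ⟨q', h', hq'⟩
        cases h'
        exact hq (by rw [completion_unique (length_pos_of_cut hc) hr hq'])
      · intro h
        exact absurd ((Set.Finite.mem_toFinset S.finite_completable).2
          ⟨p, comp_mem_cycles hr⟩) h
    · rw [Finset.sum_eq_zero, sub_zero]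
      · exact ofPath_mem_ideal K hmult (length_pos_of_cut hc) hp
      · rintro ⟨c, d, q⟩ -
        change S.traceForm K (ofPath K p * ofPath K q) • _ = _
        rw [(S.traceForm_mul_eq_zero_or K p q).resolve_right, zero_smul]
        rintro ⟨q', -, hq'⟩
        exact hp ⟨q', hq'⟩

theorem toTrivialExtension_eq_zero_iff [∀ a b : V, Finite (a ⟶ b)] {x : PathAlgebra K V} :
    toTrivialExtension K hmult hD x = 0 ↔ x ∈ S.ideal K := by
  refine ⟨fun h => ?_, toTrivialExtension_eq_zero hmult hD⟩
  have h₁ := congrArg TrivSqZeroExt.fst h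
  have h₂ := congrArg TrivSqZeroExt.snd h
  rw [fst_toTrivialExtension, TrivSqZeroExt.fst_zero, TwoSidedIdeal.mkₐ_eq_zero_iff] at h₁
  rw [snd_toTrivialExtension, TrivSqZeroExt.snd_zero] at h₂
  have h₃ := cutPart_sub_sum_mem_ideal hmult hD x
  simp_rw [← dualPart_apply hmult hD, h₂] at h₃
  simp only [DualBimodule.zero_apply, zero_smul, Finset.sum_const_zero, sub_zero] at h₃
  -- Now `x` is the sum of its cut part, in I_Λ as its functional vanishes, and its part off `D`, in
  -- I_Λ as its class in the cut algebra vanishes.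
  have := TwoSidedIdeal.add_mem _ h₃
    (extend_mem_ideal hmult (restrict_mem_gentleIdeal hmult hD h₁))
  rwa [cutPart_apply, sub_add_cancel] at this

theorem toTrivialExtension_surjective [∀ a b : V, Finite (a ⟶ b)]
    (hV : ∀ a : V, ∃ e : Total V, e.left = a ∨ e.right = a) :
    Function.Surjective (toTrivialExtension K hmult hD) := by
  rintro ⟨a, f⟩
  obtain ⟨x, rfl⟩ := (S.cutIdeal K D).ringCon.mkₐ_surjective (α := K) a
  -- A lift `x` of `a` has its cut part exchanged for a combination of dual paths representing `f`;
  -- cut parts vanish in the cut algebra, so the first component is unaffected.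
  refine ⟨x - cutPart K D x + cutPart K D (∑ p ∈ S.finite_completable.toFinset,
      f ((S.cutIdeal K D).ringCon.mkₐ K (ofAnyPath K p)) • S.dualPath K D p),
    TrivSqZeroExt.ext ?_ ?_⟩
  · rw [fst_toTrivialExtension, map_add, map_sub, mkₐ_cutPart, mkₐ_cutPart, sub_zero, add_zero]
    rfl
  · rw [snd_toTrivialExtension, map_add, map_sub, dualPart_cutPart, dualPart_cutPart, sub_self,
      zero_add, dual_eq_dualPart_sum hmult hD hV]
    rfl

/-- The algebra of a defining pair is the trivial extension of the cut algebra. -/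
def trivialExtensionEquiv [∀ a b : V, Finite (a ⟶ b)]
    (hV : ∀ a : V, ∃ e : Total V, e.left = a ∨ e.right = a) :
    TrivialExtension K (S.cutAlgebra K D) ≃ₐ[K] S.algebra K :=
  (AlgEquiv.ofBijective ((S.ideal K).liftAlgHom (toTrivialExtension K hmult hD)
      fun _ => toTrivialExtension_eq_zero hmult hD) <| by
    constructor
    · refine (injective_iff_map_eq_zero _).2 ?_
      intro y hy
      obtain ⟨x, rfl⟩ := (S.ideal K).ringCon.mkₐ_surjective (α := K) y
      rw [TwoSidedIdeal.liftAlgHom_mkₐ, toTrivialExtension_eq_zero_iff hmult hD] at hy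
      exact (TwoSidedIdeal.mkₐ_eq_zero_iff _).2 hy
    · intro y
      obtain ⟨x, rfl⟩ := toTrivialExtension_surjective hmult hD hV y
      exact ⟨(S.ideal K).ringCon.mkₐ K x, rfl⟩).symm

end Bijective

end DefiningPair

end

theorem theorem5p4 {K : Type k} [Field K] {V : Type u} [Fintype V] [Quiver.{v} V]
    [∀ a b : V, Finite (a ⟶ b)]
    (hV : ∀ a : V, ∃ e : Quiver.Total V, e.left = a ∨ e.right = a)
    (S : DefiningPair V)
    (hmult : ∀ (a : V) (C : Quiver.Path a a), C ∈ S.cycles a → S.mult C = 1)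
    (D : Set (Quiver.Total V)) (hD : S.IsAdmissibleCut D) :
    IsAlmostGentle.{k, u, v} K (S.cutAlgebra K D) ∧
      Nonempty (TrivialExtension K (S.cutAlgebra K D) ≃ₐ[K] S.algebra K) :=
  ⟨DefiningPair.isAlmostGentle_cutAlgebra hmult hD,
    ⟨DefiningPair.trivialExtensionEquiv hmult hD hV⟩⟩
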